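/- Let $\mathrm{SU}(1,1)$ denote the group of all matrices $\begin{bmatrix} a & \overline{b}\\ b & \overline{a}\end{bmatrix}$ with $a,b\in\mathbb{C}$ and $|a|^2-|b|^2=1$. For every integer $d\ge 2$ there exist a constant $C_d>0$ and a function $\beta_d\colon[0,\infty)\to[0,\infty)$ with the following two properties. (1) For every $\begin{bmatrix} a & \overline{b}\\ b & \overline{a}\end{bmatrix}\in\mathrm{SU}(1,1)$, $$C_d^{-1}(\ln|a|)^{1/2}\ \le\ \beta_d(|b|)\ \le\ C_d(\ln|a|)^{1/2}.$$ (2) Whenever matrices $\begin{bmatrix} a_j & \overline{b_j}\\ b_j & \overline{a_j}\end{bmatrix}$ and $\begin{bmatrix} A_k & \overline{B_k}\\ B_k & \overline{A_k}\end{bmatrix}$ in $\mathrm{SU}(1,1)$, $j,k=0,1,\dots,d-1$, satisfy $$\begin{bmatrix} A_k & \overline{B_k}\\ B_k & \overline{A_k}\end{bmatrix}=\prod_{j=0}^{d-1}\begin{bmatrix} a_j & \overline{b_j}\,e^{-2\pi i jk/d}\\ b_j\,e^{2\pi i jk/d} & \overline{a_j}\end{bmatrix}\qquad(k=0,1,\dots,d-1),$$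 where the product is taken in ascending order of $j$ from left to right, then for every pair of conjugate exponents $1<p\le 2$ and $2\le q<\infty$, $\frac1p+\frac1q=1$, $$\Big(\frac1d\sum_{k=0}^{d-1}\beta_d(|B_k|)^q\Big)^{1/q}\ \le\ \Big(\sum_{j=0}^{d-1}\beta_d(|b_j|)^p\Big)^{1/p}.$$ -/

import Mathlib

open scoped NNReal ComplexConjugate

/-- The matrix with rows `(a, conj b)` and `(b, conj a)`. -/
def su11Matrix (a b : ℂ) : Matrix (Fin 2) (Fin 2) ℂ :=
  !![a, conj b; b, conj a]

/-- The group `SU(1,1)`, as a set of complex `2 × 2` matrices. -/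
def SU11 : Set (Matrix (Fin 2) (Fin 2) ℂ) :=
  {M | ∃ a b : ℂ, ‖a‖ ^ 2 - ‖b‖ ^ 2 = 1 ∧ M = su11Matrix a b}

/-- The matrix with rows `(a, conj b * exp (-2πijk/d))` and `(b * exp (2πijk/d), conj a)`. -/
noncomputable def twistedMatrix (d j k : ℕ) (a b : ℂ) : Matrix (Fin 2) (Fin 2) ℂ :=
  !![a, conj b * Complex.exp (-(2 * Real.pi * Complex.I * j * k / d));
     b * Complex.exp (2 * Real.pi * Complex.I * j * k / d), conj a]

/-- The ordered product over `j = 0, 1, ..., d - 1` (ascending from left to right) of the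
twisted matrices with frequency `k`. -/
noncomputable def twistedProduct (d k : ℕ) (a b : Fin d → ℂ) : Matrix (Fin 2) (Fin 2) ℂ :=
  (List.ofFn fun j : Fin d => twistedMatrix d j k (a j) (b j)).prod

/-!
For a small scale `ε`, depending on `d` only, the gauge is `β(t) = ε √(log (1 + (t / ε) ^ 2))`.
Write `m` and `l` for the indices of the largest and the second largest `|b_j|`.

If `|b_l|` is large compared with `ε`, the crude bound `|B_k| ≤ sinh (∑ arsinh |b_j|)`, which loses
a factor `2 ^ d`, is already enough for `log (1 + (|B_k| / ε) ^ 2) ≤ ∑ log (1 + (|b_j| / ε) ^ 2)`: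
the factors `1 + (|b_m| / ε) ^ 2` and `1 + (|b_l| / ε) ^ 2` gain a power of `1 / ε`.

Otherwise `B` is the Fourier transform of a vector `c` with `|c_j|` close to `|b_j|`. Put
`ξ_j = |b_j| / ε` and bound `u ↦ log (1 + u)` by its tangent at `V = ∑ ξ_j ^ 2`. The tangent bound
is affine in `|B_k| ^ 2`, and its constant term is a multiple of `∑ ξ_j ^ 2`; so it is the squared
norm of the Fourier transform of a vector-valued function, whose value at `j` has an extra
component proportional to `ξ_j`. The vector-valued Hausdorff–Young inequality applies. With
`c_j = b_j` the right-hand side would be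
`∑ (ξ_j ^ 2 * log (1 + V) / V) ^ (p / 2)`, which is at most `∑ log (1 + ξ_j ^ 2) ^ (p / 2)` because
the slope `log (1 + v) / v` is decreasing. At `j = l` the inequality is strict, since
`V - ξ_l ^ 2 ≥ ξ_m ^ 2`, and for small `ε` this gain absorbs the errors `|c_j| - |b_j|`.
-/

section HausdorffYoung

open Complex.HadamardThreeLines

variable {ι κ E : Type*} [Fintype ι] [Fintype κ] [NormedAddCommGroup E] [InnerProductSpace ℂ E]

/-- The analytic family `z ↦ ‖v‖ ^ (r (1 - z / 2) - 1) • v` of Thorin's interpolation argument,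
written with the exponential so that it is entire in `z` also for `v = 0`. -/
noncomputable def thorinFamily (r : ℝ) (v : E) (z : ℂ) : E :=
  Complex.exp (Real.log ‖v‖ * (r * (1 - z / 2) - 1)) • v

lemma norm_thorinFamily {r : ℝ} (hr : 0 < r) (v : E) {z : ℂ} (hz : z.re ≤ 1) :
    ‖thorinFamily r v z‖ = ‖v‖ ^ (r * (1 - z.re / 2)) := by
  have hexp : 0 < r * (1 - z.re / 2) := mul_pos hr (by linarith)
  rcases (norm_nonneg v).eq_or_lt with hv | hv
  · rw [norm_eq_zero.1 hv.symm, thorinFamily, smul_zero, norm_zero, Real.zero_rpow hexp.ne']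
  · have hre : (Real.log ‖v‖ * (r * (1 - z / 2) - 1) : ℂ).re =
        Real.log ‖v‖ * (r * (1 - z.re / 2)) - Real.log ‖v‖ := by
      simp [Complex.mul_re, mul_sub]
    rw [thorinFamily, norm_smul, Complex.norm_exp, hre, Real.exp_sub, Real.exp_log hv,
      div_mul_cancel₀ _ hv.ne', Real.rpow_def_of_pos hv]

lemma norm_thorinFamily_le {r : ℝ} (hr : 0 < r) (v : E) {z : ℂ}
    (hz : z ∈ verticalClosedStrip 0 1) : ‖thorinFamily r v z‖ ≤ (1 + ‖v‖) ^ r := by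
  obtain ⟨hz0, hz1⟩ : 0 ≤ z.re ∧ z.re ≤ 1 := hz
  rw [norm_thorinFamily hr v hz1]
  calc ‖v‖ ^ (r * (1 - z.re / 2)) ≤ (1 + ‖v‖) ^ (r * (1 - z.re / 2)) := by
        gcongr
        · exact mul_nonneg hr.le (by linarith)
        · linarith
    _ ≤ (1 + ‖v‖) ^ r :=
        Real.rpow_le_rpow_of_exponent_le (by linarith [norm_nonneg v]) (by nlinarith)

lemma thorinFamily_ofReal (r : ℝ) (v : E) (x : ℝ) :
    thorinFamily r v x = ((‖v‖ ^ (r * (1 - x / 2) - 1) : ℝ) : ℂ) • v := by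
  rcases (norm_nonneg v).eq_or_lt with hv | hv
  · simp [thorinFamily, norm_eq_zero.1 hv.symm]
  · rw [thorinFamily, Real.rpow_def_of_pos hv]
    push_cast
    rfl

lemma inner_thorinFamily_conj (r : ℝ) (w x : E) (z : ℂ) :
    inner ℂ (thorinFamily r w (conj z)) x =
      Complex.exp (Real.log ‖w‖ * (r * (1 - z / 2) - 1)) * inner ℂ w x := by
  rw [thorinFamily, inner_smul_left, ← Complex.exp_conj]
  simp [map_ofNat]

/-- The form `∑ₖ ⟪Wₖ, (T v)ₖ⟫` evaluated along Thorin's families of `W` and `v`; the conjugate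
compensates for the conjugate linearity of the inner product in its first argument. -/
noncomputable def thorinForm (T : Matrix κ ι ℂ) (q p : ℝ) (W : κ → E) (v : ι → E) (z : ℂ) : ℂ :=
  ∑ k, inner ℂ (thorinFamily q (W k) (conj z)) (∑ j, T k j • thorinFamily p (v j) z)

lemma differentiable_thorinForm (T : Matrix κ ι ℂ) (q p : ℝ) (W : κ → E) (v : ι → E) :
    Differentiable ℂ (thorinForm T q p W v) := by
  unfold thorinForm
  simp only [inner_thorinFamily_conj]
  simp only [inner_sum, inner_smul_right, thorinFamily]
  fun_prop

lemma norm_thorinForm_le_sum_mul_sum {T : Matrix κ ι ℂ} (hT : ∀ k j, ‖T k j‖ ≤ 1) (q p : ℝ)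
    (W : κ → E) (v : ι → E) (z : ℂ) :
    ‖thorinForm T q p W v z‖ ≤
      (∑ k, ‖thorinFamily q (W k) (conj z)‖) * ∑ j, ‖thorinFamily p (v j) z‖ := by
  rw [Finset.sum_mul]
  refine (norm_sum_le _ _).trans (Finset.sum_le_sum fun k _ => (norm_inner_le_norm _ _).trans ?_)
  gcongr
  refine (norm_sum_le _ _).trans (Finset.sum_le_sum fun j _ => ?_)
  rw [norm_smul]
  exact mul_le_of_le_one_left (norm_nonneg _) (hT k j)

lemma norm_thorinForm_le_sqrt {T : Matrix κ ι ℂ} {D : ℝ}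
    (hD : ∀ v : ι → E, ∑ k, ‖∑ j, T k j • v j‖ ^ 2 ≤ D * ∑ j, ‖v j‖ ^ 2) (q p : ℝ)
    (W : κ → E) (v : ι → E) (z : ℂ) :
    ‖thorinForm T q p W v z‖ ≤ √(∑ k, ‖thorinFamily q (W k) (conj z)‖ ^ 2) *
      √(D * ∑ j, ‖thorinFamily p (v j) z‖ ^ 2) :=
  calc ‖thorinForm T q p W v z‖
      ≤ ∑ k, ‖thorinFamily q (W k) (conj z)‖ * ‖∑ j, T k j • thorinFamily p (v j) z‖ :=
        (norm_sum_le _ _).trans (Finset.sum_le_sum fun k _ => norm_inner_le_norm _ _)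
    _ ≤ _ := Real.sum_mul_le_sqrt_mul_sqrt _ _ _
    _ ≤ _ := by gcongr; exact hD _

lemma norm_thorinForm_ofReal_le {T : Matrix κ ι ℂ} (hT : ∀ k j, ‖T k j‖ ≤ 1) {D : ℝ}
    (hD : ∀ v : ι → E, ∑ k, ‖∑ j, T k j • v j‖ ^ 2 ≤ D * ∑ j, ‖v j‖ ^ 2) {q p : ℝ}
    (hq : 0 < q) (hp : 0 < p) (W : κ → E) (v : ι → E) {x : ℝ} (hx : x ∈ Set.Icc (0 : ℝ) 1) :
    ‖thorinForm T q p W v x‖ ≤ ((∑ k, ‖W k‖ ^ q) * ∑ j, ‖v j‖ ^ p) ^ (1 - x) *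
      √((∑ k, ‖W k‖ ^ q) * (D * ∑ j, ‖v j‖ ^ p)) ^ x := by
  have sq_norm {r : ℝ} (hr : 0 < r) (u : E) {z : ℂ} (hz : z.re = 1) :
      ‖thorinFamily r u z‖ ^ 2 = ‖u‖ ^ r := by
    rw [norm_thorinFamily hr u hz.le, ← Real.rpow_mul_natCast (norm_nonneg u), hz]
    congr 1
    push_cast
    ring
  refine norm_le_interp_of_mem_verticalClosedStrip₀₁' _ hx
    (differentiable_thorinForm T q p W v).diffContOnCl ?_ ?_ ?_
  · refine ⟨(∑ k, (1 + ‖W k‖) ^ q) * ∑ j, (1 + ‖v j‖) ^ p, ?_⟩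
    rintro _ ⟨z, hz, rfl⟩
    refine (norm_thorinForm_le_sum_mul_sum hT q p W v z).trans ?_
    gcongr
    · exact norm_thorinFamily_le hq _ hz
    · exact norm_thorinFamily_le hp _ hz
  · intro z (hz : z.re = 0)
    refine (norm_thorinForm_le_sum_mul_sum hT q p W v z).trans_eq ?_
    simp only [norm_thorinFamily hq _ (show (conj z).re ≤ 1 by simp [hz]),
      norm_thorinFamily hp _ (show z.re ≤ 1 by simp [hz]), Complex.conj_re, hz, zero_div,
      sub_zero, mul_one]
  · intro z (hz : z.re = 1)
    refine (norm_thorinForm_le_sqrt hD q p W v z).trans_eq ?_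
    simp only [sq_norm hq _ (show (conj z).re = 1 from hz), sq_norm hp _ hz]
    rw [Real.sqrt_mul (Finset.sum_nonneg fun k _ => by positivity)]

lemma thorinForm_two_div {p q : ℝ} (hpq : p.HolderConjugate q) (T : Matrix κ ι ℂ) (v : ι → E) :
    thorinForm T q p (fun k => ∑ j, T k j • v j) v (2 / q : ℝ) =
      ((∑ k, ‖∑ j, T k j • v j‖ ^ q : ℝ) : ℂ) := by
  have hv (u : E) : thorinFamily p u (2 / q : ℝ) = u := by
    have hexp : p * (1 - 2 / q / 2) - 1 = 0 := by
      rw [div_div, mul_comm q, ← div_div, div_self two_ne_zero, one_div, hpq.symm.one_sub_inv,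
        mul_inv_cancel₀ hpq.ne_zero, sub_self]
    rw [thorinFamily_ofReal, hexp, Real.rpow_zero, Complex.ofReal_one, one_smul]
  have hV (u : E) : inner ℂ (thorinFamily q u (2 / q : ℝ)) u = ((‖u‖ ^ q : ℝ) : ℂ) := by
    have hexp : q * (1 - 2 / q / 2) - 1 + (2 : ℕ) = q := by
      have := hpq.symm.ne_zero
      field_simp
      push_cast
      ring
    rw [thorinFamily_ofReal, inner_smul_left, Complex.conj_ofReal, inner_self_eq_norm_sq_to_K]
    change ((‖u‖ ^ (q * (1 - 2 / q / 2) - 1) : ℝ) : ℂ) * (‖u‖ : ℂ) ^ 2 = _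
    rw [← Complex.ofReal_pow, ← Complex.ofReal_mul,
      ← Real.rpow_add_natCast' (norm_nonneg u) (by rw [hexp]; exact hpq.symm.ne_zero), hexp]
  simp only [thorinForm, Complex.conj_ofReal, hv, hV, Complex.ofReal_sum]

theorem hausdorffYoung_of_l2_bound {T : Matrix κ ι ℂ} (hT : ∀ k j, ‖T k j‖ ≤ 1) {D : ℝ}
    (hD0 : 0 < D) (hD : ∀ v : ι → E, ∑ k, ‖∑ j, T k j • v j‖ ^ 2 ≤ D * ∑ j, ‖v j‖ ^ 2)
    {p q : ℝ} (hpq : p.HolderConjugate q) (hp : p ≤ 2) (v : ι → E) :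
    ((1 / D) * ∑ k, ‖∑ j, T k j • v j‖ ^ q) ^ (1 / q) ≤ (∑ j, ‖v j‖ ^ p) ^ (1 / p) := by
  have hq0 := hpq.symm.pos
  have hq2 : 2 ≤ q := by
    have := hpq.symm.inv_add_inv_eq_one
    have : 2⁻¹ ≤ p⁻¹ := inv_anti₀ hpq.pos hp
    exact (inv_le_inv₀ hq0 two_pos).1 (by linarith)
  set X : ℝ := ∑ j, ‖v j‖ ^ p
  set Y : ℝ := ∑ k, ‖∑ j, T k j • v j‖ ^ q
  have hX : 0 ≤ X := by positivity
  have hY : 0 ≤ Y := by positivity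
  have interpolated : Y ≤ (Y * X) ^ (1 - 2 / q) * √(Y * (D * X)) ^ (2 / q) := by
    have := norm_thorinForm_ofReal_le hT hD hq0 hpq.pos (fun k => ∑ j, T k j • v j) v
      (x := 2 / q) ⟨by positivity, (div_le_one hq0).2 hq2⟩
    rwa [thorinForm_two_div hpq, Complex.norm_real, Real.norm_of_nonneg hY] at this
  rcases hY.eq_or_lt with hY' | hYpos
  · rw [← hY', mul_zero, Real.zero_rpow (by positivity)]
    positivity
  have bilinear : Y ≤ D ^ (1 / q) * (Y ^ (1 / p) * X ^ (1 / p)) :=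
    calc Y ≤ (Y * X) ^ (1 - 2 / q) * √(Y * (D * X)) ^ (2 / q) := interpolated
      _ = (Y * X) ^ (1 - 2 / q) * (D ^ (1 / q) * (Y * X) ^ (1 / q)) := by
          rw [Real.sqrt_eq_rpow, ← Real.rpow_mul (by positivity), mul_left_comm Y,
            Real.mul_rpow hD0.le (by positivity), show 1 / 2 * (2 / q) = 1 / q by ring]
      _ = D ^ (1 / q) * (Y * X) ^ (1 / p) := by
          rw [mul_left_comm, ← Real.rpow_add_of_nonneg (by positivity)
            (sub_nonneg.2 ((div_le_one hq0).2 hq2)) (by positivity), one_div p,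
            ← hpq.symm.one_sub_inv]
          congr 2
          ring
      _ = D ^ (1 / q) * (Y ^ (1 / p) * X ^ (1 / p)) := by rw [Real.mul_rpow hY hX]
  have split : Y = Y ^ (1 / q) * Y ^ (1 / p) := by
    rw [← Real.rpow_add hYpos, one_div, one_div, hpq.symm.inv_add_inv_eq_one, Real.rpow_one]
  rw [one_div_mul_eq_div, Real.div_rpow hY hD0.le, div_le_iff₀ (by positivity)]
  refine le_of_mul_le_mul_right ?_ (Real.rpow_pos_of_pos hYpos (1 / p))
  rw [← split]
  linarith

end HausdorffYoung

section Hadamard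

open scoped Matrix

variable {ι : Type*} [Fintype ι] [DecidableEq ι] {T : Matrix ι ι ℂ}

lemma norm_apply_of_isHadamard (hT : T.IsHadamard) (k j : ι) : ‖T k j‖ = 1 :=
  CStarRing.norm_of_mem_unitary (hT.apply_mem k j)

lemma sum_norm_sq_sum_smul_of_isHadamard {E : Type*} [NormedAddCommGroup E]
    [InnerProductSpace ℂ E] (hT : T.IsHadamard) (v : ι → E) :
    ∑ k, ‖∑ j, T k j • v j‖ ^ 2 = Fintype.card ι * ∑ j, ‖v j‖ ^ 2 := by
  suffices h : ∑ k, inner ℂ (∑ i, T k i • v i) (∑ j, T k j • v j) =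
      Fintype.card ι * ∑ j, inner ℂ (v j) (v j) by
    simp only [inner_self_eq_norm_sq_to_K] at h
    exact Complex.ofReal_injective (by push_cast; exact h)
  calc ∑ k, inner ℂ (∑ i, T k i • v i) (∑ j, T k j • v j)
      = ∑ k, ∑ i, ∑ j, (Tᴴ i k * T k j) * inner ℂ (v i) (v j) := by
        simp_rw [sum_inner, inner_sum, inner_smul_left, inner_smul_right,
          Matrix.conjTranspose_apply, Complex.star_def, mul_assoc]
    _ = ∑ i, ∑ j, (Tᴴ * T) i j * inner ℂ (v i) (v j) := by
        simp only [Matrix.mul_apply, Finset.sum_mul]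
        rw [Finset.sum_comm]
        exact Finset.sum_congr rfl fun i _ => Finset.sum_comm
    _ = Fintype.card ι * ∑ j, inner ℂ (v j) (v j) := by
        simp [hT.conjTranspose_mul, Matrix.one_apply, Finset.mul_sum]

lemma exists_mulVec_eq_of_isHadamard [Nonempty ι] (hT : T.IsHadamard) {R : ι → ℂ} {K : ℝ}
    (hR : ∀ k, ‖R k‖ ≤ K) : ∃ e : ι → ℂ, T *ᵥ e = R ∧ ∀ j, ‖e j‖ ≤ K := by
  have hcard : (Fintype.card ι : ℂ) ≠ 0 := Nat.cast_ne_zero.2 Fintype.card_ne_zero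
  refine ⟨(Fintype.card ι : ℂ)⁻¹ • Tᴴ *ᵥ R, ?_, fun j => ?_⟩
  · rw [Matrix.mulVec_smul, Matrix.mulVec_mulVec, hT.mul_conjTranspose, Matrix.smul_mulVec,
      Matrix.one_mulVec, inv_smul_smul₀ hcard]
  · have hsum : ‖(Tᴴ *ᵥ R) j‖ ≤ Fintype.card ι * K := by
      calc ‖(Tᴴ *ᵥ R) j‖ ≤ ∑ k, ‖Tᴴ j k * R k‖ := norm_sum_le _ _
        _ ≤ ∑ _k : ι, K := by
            gcongr with k
            rw [norm_mul, norm_apply_of_isHadamard hT.conjTranspose, one_mul]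
            exact hR k
        _ = Fintype.card ι * K := by simp
    rw [Pi.smul_apply, norm_smul, norm_inv, Complex.norm_natCast]
    exact inv_mul_le_of_le_mul₀ (by positivity) ((norm_nonneg _).trans (hR j)) hsum

theorem hausdorffYoung_of_isHadamard [Nonempty ι] (hT : T.IsHadamard) {p q : ℝ}
    (hpq : p.HolderConjugate q) (hp : p ≤ 2) (c : ι → ℂ) (δ : ι → ℝ) :
    ((1 / Fintype.card ι : ℝ) * ∑ k, (‖(T *ᵥ c) k‖ ^ 2 + ∑ j, δ j ^ 2) ^ (q / 2)) ^ (1 / q) ≤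
      (∑ j, (‖c j‖ ^ 2 + δ j ^ 2) ^ (p / 2)) ^ (1 / p) := by
  let v (j : ι) : EuclideanSpace ℂ (Option ι) :=
    WithLp.toLp 2 fun o => o.elim (c j) (Pi.single j (δ j : ℂ))
  have norm_v (j : ι) : ‖v j‖ ^ 2 = ‖c j‖ ^ 2 + δ j ^ 2 := by
    simp [v, EuclideanSpace.norm_sq_eq, Pi.single_apply, apply_ite]
  have norm_sum (k : ι) : ‖∑ j, T k j • v j‖ ^ 2 = ‖(T *ᵥ c) k‖ ^ 2 + ∑ j, δ j ^ 2 := by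
    simp [v, EuclideanSpace.norm_sq_eq, Pi.single_apply, norm_apply_of_isHadamard hT,
      Matrix.mulVec, dotProduct]
  have rpow_norm {r : ℝ} (u : EuclideanSpace ℂ (Option ι)) : ‖u‖ ^ r = (‖u‖ ^ 2) ^ (r / 2) := by
    rw [← Real.rpow_natCast_mul (norm_nonneg u)]
    congr 1
    push_cast
    ring
  have := hausdorffYoung_of_l2_bound (fun k j => (norm_apply_of_isHadamard hT k j).le)
    (D := Fintype.card ι) (by positivity)
    (fun w : ι → EuclideanSpace ℂ (Option ι) =>
      (sum_norm_sq_sum_smul_of_isHadamard hT w).le) hpq hp v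
  simpa only [rpow_norm, norm_v, norm_sum] using this

lemma isHadamard_of_isPrimitiveRoot {d : ℕ} (hd : d ≠ 0) {ζ : ℂ} (hζ : IsPrimitiveRoot ζ d) :
    (Matrix.of fun k j : Fin d => ζ ^ (j * k : ℕ)).IsHadamard := by
  have star_root : star ζ = ζ⁻¹ := (RCLike.inv_eq_conj (hζ.norm'_eq_one hd)).symm
  have root_ne : ζ ≠ 0 := hζ.ne_zero hd
  refine .of_mul_conjTranspose (fun k j => ?_) ?_ ?_
  · exact pow_mem (Unitary.mem_iff.2 (by simp [star_root, root_ne])) _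
  · ext k l
    set z := ζ ^ (k : ℕ) / ζ ^ (l : ℕ) with hz
    have hterm (j : Fin d) : ζ ^ (j * k : ℕ) * star (ζ ^ (j * l : ℕ)) = z ^ (j : ℕ) := by
      rw [star_pow, star_root, inv_pow, hz, div_pow, ← pow_mul, ← pow_mul, div_eq_mul_inv,
        mul_comm (k : ℕ), mul_comm (l : ℕ)]
    simp only [Matrix.mul_apply, Matrix.conjTranspose_apply, Matrix.of_apply, hterm,
      Matrix.smul_apply, Matrix.one_apply, Fintype.card_fin, Fin.sum_univ_eq_sum_range (z ^ ·)]
    rcases eq_or_ne k l with rfl | hkl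
    · simp [hz, root_ne]
    · have hz_ne : z ≠ 1 := fun h =>
        hkl (Fin.ext (hζ.pow_inj k.2 l.2 ((div_eq_one_iff_eq (pow_ne_zero _ root_ne)).1 h)))
      have hz_pow : z ^ d = 1 := by
        rw [hz, div_pow, pow_right_comm, pow_right_comm ζ l, hζ.pow_eq_one, one_pow, one_pow,
          div_one]
      rw [geom_sum_eq hz_ne, hz_pow, sub_self, zero_div, if_neg hkl, smul_zero]
  · rw [Fintype.card_fin]
    exact IsRegular.of_ne_zero (Nat.cast_ne_zero.2 hd)

/-- The (unnormalized) Fourier matrix, with entries `exp (2πi j k / d)`. -/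
noncomputable def fourierMatrix (d : ℕ) : Matrix (Fin d) (Fin d) ℂ :=
  Matrix.of fun k j => Complex.exp (2 * Real.pi * Complex.I / d) ^ (j * k : ℕ)

lemma isHadamard_fourierMatrix {d : ℕ} (hd : d ≠ 0) : (fourierMatrix d).IsHadamard :=
  isHadamard_of_isPrimitiveRoot hd (Complex.isPrimitiveRoot_exp d hd)

end Hadamard

section Hyperbolic

lemma sinh_le_mul_cosh {x : ℝ} (hx : 0 ≤ x) : Real.sinh x ≤ x * Real.cosh x := by
  have hderiv : ∀ y ∈ interior (Set.Icc 0 x), deriv Real.sinh y ≤ Real.cosh x := fun y hy => by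
    rw [interior_Icc] at hy
    rw [Real.deriv_sinh, Real.cosh_le_cosh, abs_of_pos hy.1, abs_of_nonneg hx]
    exact hy.2.le
  have := (convex_Icc 0 x).image_sub_le_mul_sub_of_deriv_le Real.continuous_sinh.continuousOn
    Real.differentiable_sinh.differentiableOn hderiv 0 (Set.left_mem_Icc.2 hx) x
    (Set.right_mem_Icc.2 hx) hx
  simpa [mul_comm] using this

lemma exp_le_one_add_two_mul {x : ℝ} (h0 : 0 ≤ x) (h1 : x ≤ 1) : Real.exp x ≤ 1 + 2 * x := by
  have h := (le_abs_self _).trans (Real.abs_exp_sub_one_le (by rwa [abs_of_nonneg h0]))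
  rw [abs_of_nonneg h0] at h
  linarith

lemma cosh_le_one_add_sq {x : ℝ} (h0 : 0 ≤ x) (h1 : x ≤ 1) : Real.cosh x ≤ 1 + x ^ 2 :=
  (Real.cosh_le_exp_half_sq x).trans <|
    (exp_le_one_add_two_mul (by positivity) (by nlinarith)).trans_eq (by ring)

lemma sinh_le_add_pow_three {x : ℝ} (h0 : 0 ≤ x) (h1 : x ≤ 1) : Real.sinh x ≤ x + x ^ 3 :=
  (sinh_le_mul_cosh h0).trans <|
    (mul_le_mul_of_nonneg_left (cosh_le_one_add_sq h0 h1) h0).trans_eq (by ring)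

lemma prod_cosh_le_one_add {ι : Type*} (s : Finset ι) {t : ι → ℝ} {x : ℝ}
    (hx : ∑ i ∈ s, t i ^ 2 ≤ x) (hx1 : x ≤ 2) : ∏ i ∈ s, Real.cosh (t i) ≤ 1 + x := by
  have hx0 : 0 ≤ x := (Finset.sum_nonneg fun i _ => sq_nonneg (t i)).trans hx
  calc ∏ i ∈ s, Real.cosh (t i) ≤ ∏ i ∈ s, Real.exp (t i ^ 2 / 2) :=
        Finset.prod_le_prod (fun i _ => (Real.cosh_pos _).le) fun i _ => Real.cosh_le_exp_half_sq _
    _ = Real.exp ((∑ i ∈ s, t i ^ 2) / 2) := by rw [← Real.exp_sum, Finset.sum_div]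
    _ ≤ Real.exp (x / 2) := by gcongr
    _ ≤ 1 + x := (exp_le_one_add_two_mul (by positivity) (by linarith)).trans_eq (by ring)

lemma sinh_add_sum_le {ι : Type*} (s : Finset ι) {t : ι → ℝ} {τ : ℝ}
    (ht : ∀ j ∈ s, 0 ≤ t j ∧ t j ≤ τ) :
    Real.sinh (τ + ∑ j ∈ s, t j) ≤ 2 ^ s.card * (Real.sinh τ * ∏ j ∈ s, Real.cosh (t j)) := by
  classical
  induction s using Finset.induction_on with
  | empty => simp
  | insert i s hi ih =>
    rw [Finset.forall_mem_insert] at ht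
    obtain ⟨⟨_, hiτ⟩, hs⟩ := ht
    set X := τ + ∑ j ∈ s, t j
    have hsub : 0 ≤ Real.sinh (X - t i) :=
      Real.sinh_nonneg_iff.2 (by linarith [Finset.sum_nonneg fun j hj => (hs j hj).1])
    rw [Real.sinh_sub] at hsub
    calc Real.sinh (τ + ∑ j ∈ insert i s, t j)
        = Real.sinh X * Real.cosh (t i) + Real.cosh X * Real.sinh (t i) := by
          rw [Finset.sum_insert hi, add_left_comm, add_comm, Real.sinh_add]
      _ ≤ 2 * (Real.sinh X * Real.cosh (t i)) := by linarith
      _ ≤ 2 * (2 ^ s.card * (Real.sinh τ * ∏ j ∈ s, Real.cosh (t j)) * Real.cosh (t i)) := by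
          gcongr
          exact ih hs
      _ = _ := by rw [Finset.card_insert_of_notMem hi, Finset.prod_insert hi]; ring

end Hyperbolic

section SU11Products

/-- The ordered product of the matrices `su11Matrix (a j) (w j)`, ascending from left to right. -/
def su11Prod {n : ℕ} (a w : Fin n → ℂ) : Matrix (Fin 2) (Fin 2) ℂ :=
  (List.ofFn fun j => su11Matrix (a j) (w j)).prod

/-- The coefficient of `w j` in the part of degree one in `w` of the lower left entry of
`su11Prod a w`. Allowing any star ring `R` lets the same definition produce the majorant of the
complex coefficients, over `ℝ`. -/
def linCoeff {R : Type*} [CommSemiring R] [StarRing R] {n : ℕ} (a : Fin n → R) (j : Fin n) : R :=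
  ∏ i, if i < j then star (a i) else if i = j then 1 else a i

lemma linCoeff_zero {R : Type*} [CommSemiring R] [StarRing R] {n : ℕ} (a : Fin (n + 1) → R) :
    linCoeff a 0 = ∏ i : Fin n, a i.succ := by
  simp [linCoeff, Fin.prod_univ_succ]

lemma linCoeff_succ {R : Type*} [CommSemiring R] [StarRing R] {n : ℕ} (a : Fin (n + 1) → R)
    (j : Fin n) : linCoeff a j.succ = star (a 0) * linCoeff (fun i => a i.succ) j := by
  simp [linCoeff, Fin.prod_univ_succ]

lemma norm_linCoeff {n : ℕ} (a : Fin n → ℂ) (j : Fin n) :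
    ‖linCoeff a j‖ = linCoeff (fun i => ‖a i‖) j := by
  simp only [linCoeff, norm_prod, apply_ite norm, norm_star, norm_one, star_trivial]

lemma linCoeff_real {n : ℕ} (a : Fin n → ℝ) (j : Fin n) :
    linCoeff a j = ∏ i ∈ Finset.univ.erase j, a i := by
  rw [linCoeff, ← Finset.mul_prod_erase _ _ (Finset.mem_univ j), if_neg (lt_irrefl j), if_pos rfl,
    one_mul]
  refine Finset.prod_congr rfl fun i hi => ?_
  rw [star_trivial, if_neg (Finset.ne_of_mem_erase hi), ite_self]

variable {n : ℕ}

lemma su11Prod_succ_zero_zero (a w : Fin (n + 1) → ℂ) :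
    su11Prod a w 0 0 = a 0 * su11Prod (fun j => a j.succ) (fun j => w j.succ) 0 0 +
      conj (w 0) * su11Prod (fun j => a j.succ) (fun j => w j.succ) 1 0 := by
  simp [su11Prod, List.ofFn_succ, Matrix.mul_apply, su11Matrix]

lemma su11Prod_succ_one_zero (a w : Fin (n + 1) → ℂ) :
    su11Prod a w 1 0 = w 0 * su11Prod (fun j => a j.succ) (fun j => w j.succ) 0 0 +
      conj (a 0) * su11Prod (fun j => a j.succ) (fun j => w j.succ) 1 0 := by
  simp [su11Prod, List.ofFn_succ, Matrix.mul_apply, su11Matrix]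

lemma norm_su11Prod_le {a w : Fin n → ℂ} {t : Fin n → ℝ} (ha : ∀ j, ‖a j‖ ≤ Real.cosh (t j))
    (hw : ∀ j, ‖w j‖ ≤ Real.sinh (t j)) :
    ‖su11Prod a w 0 0‖ ≤ Real.cosh (∑ j, t j) ∧ ‖su11Prod a w 1 0‖ ≤ Real.sinh (∑ j, t j) := by
  induction n with
  | zero => simp [su11Prod]
  | succ n ih =>
    obtain ⟨h0, h1⟩ := ih (fun j => ha j.succ) (fun j => hw j.succ)
    have hsinh := (norm_nonneg _).trans (hw 0)
    rw [Fin.sum_univ_succ, Real.cosh_add, Real.sinh_add, su11Prod_succ_zero_zero,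
      su11Prod_succ_one_zero]
    constructor <;>
    · refine (norm_add_le _ _).trans ?_
      simp only [norm_mul, RCLike.norm_conj]
      gcongr <;> first | exact (Real.cosh_pos _).le | exact ha 0 | exact hw 0

lemma norm_su11Prod_zero_zero_sub_le {a w : Fin n → ℂ} {t : Fin n → ℝ}
    (ha : ∀ j, ‖a j‖ ≤ Real.cosh (t j)) (hw : ∀ j, ‖w j‖ ≤ Real.sinh (t j)) :
    ‖su11Prod a w 0 0 - ∏ j, a j‖ ≤ Real.cosh (∑ j, t j) - ∏ j, Real.cosh (t j) := by
  induction n with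
  | zero => simp [su11Prod]
  | succ n ih =>
    have hsinh := (norm_nonneg _).trans (hw 0)
    have h0 := ih (fun j => ha j.succ) (fun j => hw j.succ)
    have h1 := (norm_su11Prod_le (fun j => ha j.succ) (fun j => hw j.succ)).2
    rw [Fin.sum_univ_succ, Fin.prod_univ_succ, Fin.prod_univ_succ, Real.cosh_add,
      su11Prod_succ_zero_zero, add_sub_right_comm, ← mul_sub, add_sub_right_comm, ← mul_sub]
    refine (norm_add_le _ _).trans ?_
    simp only [norm_mul, RCLike.norm_conj]
    gcongr
    · exact ha 0
    · exact hw 0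

lemma norm_su11Prod_one_zero_sub_le {a w : Fin n → ℂ} {t : Fin n → ℝ}
    (ha : ∀ j, ‖a j‖ ≤ Real.cosh (t j)) (hw : ∀ j, ‖w j‖ ≤ Real.sinh (t j)) :
    ‖su11Prod a w 1 0 - ∑ j, linCoeff a j * w j‖ ≤
      Real.sinh (∑ j, t j) - ∑ j, linCoeff (fun i => Real.cosh (t i)) j * Real.sinh (t j) := by
  induction n with
  | zero => simp [su11Prod]
  | succ n ih =>
    have hsinh := (norm_nonneg _).trans (hw 0)
    have h0 := norm_su11Prod_zero_zero_sub_le (fun j => ha j.succ) (fun j => hw j.succ)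
    have h1 := ih (fun j => ha j.succ) (fun j => hw j.succ)
    simp only [Fin.sum_univ_succ, linCoeff_zero, linCoeff_succ, Real.sinh_add, mul_assoc,
      ← Finset.mul_sum, su11Prod_succ_one_zero]
    calc _ = ‖w 0 * (su11Prod (fun j => a j.succ) (fun j => w j.succ) 0 0 - ∏ j : Fin n, a j.succ)
            + star (a 0) * (su11Prod (fun j => a j.succ) (fun j => w j.succ) 1 0 -
              ∑ j : Fin n, linCoeff (fun i => a i.succ) j * w j.succ)‖ := by
          rw [Complex.star_def]
          congr 1
          ring
      _ ≤ Real.sinh (t 0) * (Real.cosh (∑ j : Fin n, t j.succ) - ∏ j : Fin n, Real.cosh (t j.succ))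
            + Real.cosh (t 0) * (Real.sinh (∑ j : Fin n, t j.succ) -
              ∑ j : Fin n, linCoeff (fun i => Real.cosh (t i.succ)) j * Real.sinh (t j.succ)) := by
          refine (norm_add_le _ _).trans ?_
          rw [norm_mul, norm_mul, norm_star]
          gcongr
          · exact hw 0
          · exact ha 0
      _ = _ := by
          rw [star_trivial]
          ring

lemma one_le_linCoeff_cosh (t : Fin n → ℝ) (j : Fin n) :
    1 ≤ linCoeff (fun i => Real.cosh (t i)) j := by
  rw [linCoeff_real]
  exact Finset.one_le_prod fun i _ => Real.one_le_cosh _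

lemma cosh_le_linCoeff_cosh (t : Fin n → ℝ) {j m : Fin n} (hjm : j ≠ m) :
    Real.cosh (t m) ≤ linCoeff (fun i => Real.cosh (t i)) j := by
  rw [linCoeff_real, ← Finset.mul_prod_erase _ _ (Finset.mem_erase.2 ⟨hjm.symm, Finset.mem_univ m⟩)]
  exact le_mul_of_one_le_right (Real.cosh_pos _).le
    (Finset.one_le_prod fun i _ => Real.one_le_cosh _)

lemma linCoeff_cosh_le (t : Fin n → ℝ) (j m : Fin n) :
    linCoeff (fun i => Real.cosh (t i)) j ≤
      Real.cosh (t m) * ∏ i ∈ Finset.univ.erase m, Real.cosh (t i) := by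
  rw [linCoeff_real, Finset.mul_prod_erase _ (fun i => Real.cosh (t i)) (Finset.mem_univ m),
    ← Finset.mul_prod_erase _ (fun i => Real.cosh (t i)) (Finset.mem_univ j)]
  exact le_mul_of_one_le_left (Finset.prod_nonneg fun i _ => (Real.cosh_pos _).le)
    (Real.one_le_cosh _)

lemma sinh_sum_sub_linear_le {t : Fin n → ℝ} (ht : ∀ j, 0 ≤ t j) (m : Fin n) :
    Real.sinh (∑ j, t j) - ∑ j, linCoeff (fun i => Real.cosh (t i)) j * Real.sinh (t j) ≤
      Real.sinh (t m) * (Real.cosh (∑ j ∈ Finset.univ.erase m, t j) - 1) +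
        Real.cosh (t m) * (Real.sinh (∑ j ∈ Finset.univ.erase m, t j) -
          ∑ j ∈ Finset.univ.erase m, t j) := by
  have hm : Real.sinh (t m) ≤ linCoeff (fun i => Real.cosh (t i)) m * Real.sinh (t m) :=
    le_mul_of_one_le_left (Real.sinh_nonneg_iff.2 (ht m)) (one_le_linCoeff_cosh t m)
  have hrest : Real.cosh (t m) * ∑ j ∈ Finset.univ.erase m, t j ≤
      ∑ j ∈ Finset.univ.erase m, linCoeff (fun i => Real.cosh (t i)) j * Real.sinh (t j) := by
    rw [Finset.mul_sum]
    refine Finset.sum_le_sum fun j hj => ?_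
    exact mul_le_mul (cosh_le_linCoeff_cosh t (Finset.ne_of_mem_erase hj))
      (Real.self_le_sinh_iff.2 (ht j)) (ht j) (zero_le_one.trans (one_le_linCoeff_cosh t j))
  rw [← Finset.add_sum_erase _ t (Finset.mem_univ m),
    ← Finset.add_sum_erase _ (fun j => _ * Real.sinh (t j)) (Finset.mem_univ m), Real.sinh_add]
  linarith

lemma sinh_sum_sub_linear_le_of_small {t : Fin n → ℝ} (ht : ∀ j, 0 ≤ t j) {m : Fin n} {ρ : ℝ}
    (hρ : 0 ≤ ρ) (htρ : ∀ j ≠ m, t j ≤ ρ) (hρm : ρ ≤ Real.sinh (t m)) (hnρ : n * ρ ≤ 1) :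
    Real.sinh (∑ j, t j) - ∑ j, linCoeff (fun i => Real.cosh (t i)) j * Real.sinh (t j) ≤
      3 * n ^ 3 * (Real.sinh (t m) * ρ ^ 2) := by
  have hn : (1 : ℝ) ≤ n := Nat.one_le_cast.2 (Fin.pos m)
  refine (sinh_sum_sub_linear_le ht m).trans ?_
  set σ := ∑ j ∈ Finset.univ.erase m, t j
  set M := Real.sinh (t m)
  have hσ0 : 0 ≤ σ := Finset.sum_nonneg fun j _ => ht j
  have hσ : σ ≤ n * ρ :=
    calc σ ≤ ∑ _j ∈ Finset.univ.erase m, ρ :=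
          Finset.sum_le_sum fun j hj => htρ j (Finset.ne_of_mem_erase hj)
      _ ≤ ∑ _j : Fin n, ρ := Finset.sum_le_univ_sum_of_nonneg fun _ => hρ
      _ = n * ρ := by simp
  have hM : 0 ≤ M := hρ.trans hρm
  have hcosh : Real.cosh (t m) ≤ 1 + M := by
    have := Real.cosh_sub_sinh (t m)
    have : Real.exp (-t m) ≤ 1 := Real.exp_le_one_iff.2 (neg_nonpos.2 (ht m))
    linarith
  have hcoshσ : Real.cosh (t m) * σ ≤ 2 * n * M :=
    calc Real.cosh (t m) * σ ≤ (1 + M) * (n * ρ) := by gcongr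
      _ = n * ρ + M * (n * ρ) := by ring
      _ ≤ n * M + M * 1 := by gcongr
      _ ≤ 2 * n * M := by nlinarith
  calc M * (Real.cosh σ - 1) + Real.cosh (t m) * (Real.sinh σ - σ)
      ≤ M * σ ^ 2 + Real.cosh (t m) * σ ^ 3 := by
        have := Real.cosh_pos (t m)
        gcongr
        · linarith [cosh_le_one_add_sq hσ0 (hσ.trans hnρ)]
        · linarith [sinh_le_add_pow_three hσ0 (hσ.trans hnρ)]
    _ = (M + Real.cosh (t m) * σ) * σ ^ 2 := by ring
    _ ≤ (n * M + 2 * n * M) * (n * ρ) ^ 2 := by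
        gcongr
        exact le_mul_of_one_le_left hM hn
    _ = 3 * n ^ 3 * (M * ρ ^ 2) := by ring

lemma prod_cosh_erase_le_one_add {t : Fin n → ℝ} (ht : ∀ j, 0 ≤ t j) {m : Fin n} {ρ : ℝ}
    (hρ : 0 ≤ ρ) (htρ : ∀ j ≠ m, t j ≤ ρ) (hnρ : n * ρ ≤ 1) :
    ∏ i ∈ Finset.univ.erase m, Real.cosh (t i) ≤ 1 + n * ρ ^ 2 := by
  have hn : (1 : ℝ) ≤ n := Nat.one_le_cast.2 (Fin.pos m)
  refine prod_cosh_le_one_add _ ?_ (by nlinarith)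
  calc ∑ i ∈ Finset.univ.erase m, t i ^ 2 ≤ ∑ _i ∈ Finset.univ.erase m, ρ ^ 2 :=
        Finset.sum_le_sum fun i hi =>
          pow_le_pow_left₀ (ht i) (htρ i (Finset.ne_of_mem_erase hi)) 2
    _ ≤ ∑ _i : Fin n, ρ ^ 2 := Finset.sum_le_univ_sum_of_nonneg fun _ => sq_nonneg ρ
    _ = n * ρ ^ 2 := by simp

lemma norm_eq_cosh_arsinh {a b : ℂ} (h : ‖a‖ ^ 2 - ‖b‖ ^ 2 = 1) :
    ‖a‖ = Real.cosh (Real.arsinh ‖b‖) := by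
  rw [Real.cosh_arsinh, eq_comm, Real.sqrt_eq_iff_mul_self_eq (by positivity) (by positivity)]
  linarith [sq ‖a‖]

lemma arsinh_le_self {x : ℝ} (hx : 0 ≤ x) : Real.arsinh x ≤ x := by
  simpa using Real.self_le_sinh_iff.2 (Real.arsinh_nonneg_iff.2 hx)

open scoped Matrix

variable {T : Matrix (Fin n) (Fin n) ℂ} {a b : Fin n → ℂ}

lemma norm_su11Prod_hadamard_le (hT : T.IsHadamard) (hab : ∀ j, ‖a j‖ ^ 2 - ‖b j‖ ^ 2 = 1)
    (k : Fin n) :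
    ‖su11Prod a (T k * b) 1 0‖ ≤ Real.sinh (∑ j, Real.arsinh ‖b j‖) :=
  (norm_su11Prod_le (fun j => (norm_eq_cosh_arsinh (hab j)).le) fun j => by
    rw [Pi.mul_apply, norm_mul, norm_apply_of_isHadamard hT, one_mul, Real.sinh_arsinh]).2

theorem exists_mulVec_eq_su11Prod (hT : T.IsHadamard) (hab : ∀ j, ‖a j‖ ^ 2 - ‖b j‖ ^ 2 = 1)
    {m : Fin n} {ρ : ℝ} (hρ : 0 ≤ ρ) (hbρ : ∀ j ≠ m, ‖b j‖ ≤ ρ) (hρm : ρ ≤ ‖b m‖)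
    (hnρ : n * ρ ≤ 1) :
    ∃ c : Fin n → ℂ, (∀ k, (T *ᵥ c) k = su11Prod a (T k * b) 1 0) ∧
      ‖c m‖ ≤ ‖b m‖ * (1 + 4 * n ^ 3 * ρ ^ 2) ∧
      ∀ j ≠ m, ‖c j‖ ≤ ‖a m‖ * (1 + 4 * n ^ 3 * ρ ^ 2) * ‖b j‖ + 4 * n ^ 3 * (‖b m‖ * ρ ^ 2) := by
  set t : Fin n → ℝ := fun j => Real.arsinh ‖b j‖ with ht
  have ht0 (j : Fin n) : 0 ≤ t j := Real.arsinh_nonneg_iff.2 (norm_nonneg _)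
  have htρ (j : Fin n) (hj : j ≠ m) : t j ≤ ρ := (arsinh_le_self (norm_nonneg _)).trans (hbρ j hj)
  have hsinh (j : Fin n) : Real.sinh (t j) = ‖b j‖ := Real.sinh_arsinh _
  have hcosh (j : Fin n) : ‖a j‖ = Real.cosh (t j) := norm_eq_cosh_arsinh (hab j)
  have hn : (1 : ℝ) ≤ n := Nat.one_le_cast.2 (Fin.pos m)
  have hprod : ∏ i ∈ Finset.univ.erase m, Real.cosh (t i) ≤ 1 + n ^ 3 * ρ ^ 2 := by
    refine (prod_cosh_erase_le_one_add ht0 hρ htρ hnρ).trans ?_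
    gcongr
    exact le_self_pow₀ hn three_ne_zero
  have : Nonempty (Fin n) := ⟨m⟩
  obtain ⟨e, hTe, he⟩ := exists_mulVec_eq_of_isHadamard hT
    (R := fun k => su11Prod a (T k * b) 1 0 - ∑ j, linCoeff a j * (T k * b) j)
    (K := 3 * n ^ 3 * (‖b m‖ * ρ ^ 2)) fun k => by
      refine (norm_su11Prod_one_zero_sub_le (fun j => (hcosh j).le) fun j => ?_).trans ?_
      · rw [Pi.mul_apply, norm_mul, norm_apply_of_isHadamard hT, one_mul, hsinh]
      · rw [← hsinh m] at hρm ⊢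
        exact sinh_sum_sub_linear_le_of_small ht0 hρ htρ hρm hnρ
  have norm_le (j : Fin n) {x : ℝ} (hx : ‖linCoeff a j‖ ≤ x) :
      ‖linCoeff a j * b j + e j‖ ≤ x * ‖b j‖ + 3 * n ^ 3 * (‖b m‖ * ρ ^ 2) := by
    refine (norm_add_le _ _).trans (add_le_add ?_ (he j))
    rw [norm_mul]
    gcongr
  simp only [norm_linCoeff, hcosh] at norm_le
  refine ⟨fun j => linCoeff a j * b j + e j, fun k => ?_, ?_, fun j _ => ?_⟩
  · have hTek : ∑ j, T k j * e j = _ := congrFun hTe k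
    simp only [Matrix.mulVec, dotProduct, mul_add, Finset.sum_add_distrib, hTek, Pi.mul_apply,
      mul_left_comm (linCoeff a _), add_sub_cancel]
  · exact (norm_le m ((linCoeff_real _ m).trans_le hprod)).trans_eq (by ring)
  · refine (norm_le j (linCoeff_cosh_le t j m)).trans ?_
    rw [hcosh]
    have := (Real.cosh_pos (t m)).le
    gcongr
    · exact hprod.trans (by nlinarith [pow_pos (zero_lt_one.trans_le hn) 3, sq_nonneg ρ])
    · norm_num

end SU11Products

section LogSlope

/-- The slope `log (1 + v) / v` of the chord of `u ↦ log (1 + u)` over `[0, v]`, for `0 < v`; at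
`v = 0` it takes the junk value `0`. -/
noncomputable def logSlope (v : ℝ) : ℝ := Real.log (1 + v) / v

lemma mul_logSlope (v : ℝ) : v * logSlope v = Real.log (1 + v) := by
  rcases eq_or_ne v 0 with rfl | hv
  · simp
  · exact mul_div_cancel₀ _ hv

lemma logSlope_nonneg {v : ℝ} (hv : 0 ≤ v) : 0 ≤ logSlope v :=
  div_nonneg (Real.log_nonneg (by linarith)) hv

lemma logSlope_le_one {v : ℝ} (hv : 0 ≤ v) : logSlope v ≤ 1 :=
  div_le_one_of_le₀ (by linarith [Real.log_le_sub_one_of_pos (by linarith : 0 < 1 + v)]) hv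

lemma log_one_add_le_tangent {u V : ℝ} (hu : 0 ≤ u) (hV : 0 ≤ V) :
    Real.log (1 + u) ≤ Real.log (1 + V) + (u - V) / (1 + V) := by
  have h := Real.log_le_sub_one_of_pos (x := (1 + u) / (1 + V)) (by positivity)
  rw [Real.log_div (by positivity) (by positivity)] at h
  have : (1 + u) / (1 + V) - 1 = (u - V) / (1 + V) := by field_simp; ring
  linarith

lemma inv_one_add_le_logSlope {V : ℝ} (hV : 0 < V) : (1 + V)⁻¹ ≤ logSlope V := by
  have h := log_one_add_le_tangent le_rfl hV.le
  rw [add_zero, Real.log_one, zero_sub, neg_div, ← sub_eq_add_neg, sub_nonneg] at h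
  rwa [logSlope, le_div_iff₀ hV, inv_mul_eq_div]

lemma intervalIntegrable_inv_one_add_mul {v : ℝ} (hv : 0 ≤ v) :
    IntervalIntegrable (fun x => (1 + v * x)⁻¹) MeasureTheory.volume 0 1 := by
  refine ContinuousOn.intervalIntegrable_of_Icc zero_le_one (ContinuousOn.inv₀ (by fun_prop) ?_)
  intro x hx
  have := mul_nonneg hv hx.1
  positivity

lemma logSlope_eq_integral {v : ℝ} (hv : 0 < v) :
    logSlope v = ∫ x in (0 : ℝ)..1, (1 + v * x)⁻¹ := by
  rw [intervalIntegral.integral_comp_add_mul (fun y => y⁻¹) hv.ne',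
    integral_inv_of_pos (by simp) (by simp [add_pos, hv])]
  simp [logSlope, div_eq_inv_mul]

theorem le_logSlope_sub_logSlope {v V : ℝ} (hv : 0 < v) (hvV : v ≤ V) :
    (V - v) / (2 * (1 + v) * (1 + V)) ≤ logSlope v - logSlope V := by
  have hV := hv.trans_le hvV
  have hlin : (V - v) / (2 * (1 + v) * (1 + V)) =
      ∫ x in (0 : ℝ)..1, (V - v) / ((1 + v) * (1 + V)) * x := by
    rw [intervalIntegral.integral_const_mul, integral_id]
    field_simp
    norm_num
  rw [logSlope_eq_integral hv, logSlope_eq_integral hV, hlin, ← intervalIntegral.integral_sub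
    (intervalIntegrable_inv_one_add_mul hv.le) (intervalIntegrable_inv_one_add_mul hV.le)]
  refine intervalIntegral.integral_mono_on zero_le_one
    (Continuous.intervalIntegrable (by fun_prop) _ _)
    ((intervalIntegrable_inv_one_add_mul hv.le).sub (intervalIntegrable_inv_one_add_mul hV.le))
    fun x ⟨hx0, hx1⟩ => ?_
  have : 0 ≤ v * x := by positivity
  have : 0 ≤ V * x := by positivity
  rw [inv_sub_inv (by positivity) (by positivity), div_mul_eq_mul_div,
    show 1 + V * x - (1 + v * x) = (V - v) * x by ring]
  have := mul_nonneg (sub_nonneg.2 hvV) hx0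
  gcongr <;> nlinarith

lemma sq_mul_logSlope_le {x V : ℝ} (hxV : x ^ 2 ≤ V) :
    x ^ 2 * logSlope V ≤ Real.log (1 + x ^ 2) := by
  rcases eq_or_ne x 0 with rfl | hx
  · simp
  have hx2 : 0 < x ^ 2 := by positivity
  rw [← mul_logSlope]
  gcongr
  refine sub_nonneg.1 (le_trans ?_ (le_logSlope_sub_logSlope hx2 hxV))
  have := sub_nonneg.2 hxV
  have := hx2.trans_le hxV
  positivity

lemma half_sub_le_rpow_sub_rpow {x y s : ℝ} (hy : 0 ≤ y) (hyx : y ≤ x) (hx : x ≤ 1)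
    (hs : 1 / 2 ≤ s) (hs1 : s ≤ 1) : (x - y) / 2 ≤ x ^ s - y ^ s := by
  rcases (hy.trans hyx).eq_or_lt with rfl | hpos
  · simp [le_antisymm hyx hy]
  have hxs : x ≤ x ^ s := by
    simpa using Real.rpow_le_rpow_of_exponent_ge hpos hx hs1
  have hbern : (y / x) ^ s ≤ 1 + s * (y / x - 1) := by
    have := rpow_one_add_le_one_add_mul_self (s := y / x - 1) (p := s)
      (by linarith [div_nonneg hy hpos.le]) (by linarith) hs1
    rwa [add_sub_cancel] at this
  have hyx1 : 0 ≤ 1 - y / x := sub_nonneg.2 (div_le_one_of_le₀ hyx hpos.le)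
  calc (x - y) / 2 = 1 / 2 * ((1 - y / x) * x) := by field_simp
    _ ≤ s * ((1 - y / x) * x ^ s) := by gcongr
    _ = x ^ s - (1 + s * (y / x - 1)) * x ^ s := by ring
    _ ≤ x ^ s - (y / x) ^ s * x ^ s := by gcongr
    _ = x ^ s - y ^ s := by rw [← Real.mul_rpow (by positivity) hpos.le, div_mul_cancel₀ _ hpos.ne']

lemma sq_rpow_half {x p : ℝ} (hx : 0 ≤ x) : (x ^ 2) ^ (p / 2) = x ^ p := by
  rw [← Real.rpow_natCast_mul hx]
  congr 1
  push_cast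
  ring

lemma sq_mul_rpow_half {x h p : ℝ} (hx : 0 ≤ x) (hh : 0 ≤ h) :
    (x ^ 2 * h) ^ (p / 2) = x ^ p * h ^ (p / 2) := by
  rw [Real.mul_rpow (sq_nonneg x) hh, sq_rpow_half hx]

theorem sq_mul_logSlope_rpow_add_le {r V p : ℝ} (hr : 0 < r) (hrV : r ^ 2 ≤ V) (hp : 1 ≤ p)
    (hp2 : p ≤ 2) :
    (r ^ 2 * logSlope V) ^ (p / 2) + (V - r ^ 2) / (4 * (1 + r ^ 2) * (1 + V)) * r ^ p ≤
      Real.log (1 + r ^ 2) ^ (p / 2) := by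
  have hr2 : 0 < r ^ 2 := by positivity
  have hV := hr2.trans_le hrV
  have hgap := le_logSlope_sub_logSlope hr2 hrV
  have hgap0 : 0 ≤ (V - r ^ 2) / (2 * (1 + r ^ 2) * (1 + V)) := by
    have := sub_nonneg.2 hrV
    positivity
  have hpow := half_sub_le_rpow_sub_rpow (s := p / 2) (logSlope_nonneg hV.le)
    (sub_nonneg.1 (hgap0.trans hgap)) (logSlope_le_one hr2.le) (by linarith) (by linarith)
  rw [← mul_logSlope, sq_mul_rpow_half hr.le (logSlope_nonneg hV.le),
    sq_mul_rpow_half hr.le (logSlope_nonneg hr2.le), mul_comm (_ / _), ← mul_add]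
  gcongr
  calc logSlope V ^ (p / 2) + (V - r ^ 2) / (4 * (1 + r ^ 2) * (1 + V))
      = logSlope V ^ (p / 2) + (V - r ^ 2) / (2 * (1 + r ^ 2) * (1 + V)) / 2 := by
        rw [div_div]; ring
    _ ≤ logSlope (r ^ 2) ^ (p / 2) := by linarith

end LogSlope

section Comparison

lemma add_mul_rpow_le_rpow_add {L u κ y s : ℝ} (hL : 0 < L) (hu : 0 < u) (huL : u ≤ κ * L)
    (hκ : 1 ≤ κ) (hy : 0 ≤ y) (hs : 0 ≤ s) (hs1 : s ≤ 1) :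
    (L + y * u) ^ s ≤ L ^ s + κ * y * u ^ s := by
  have hκs : κ ^ (1 - s) ≤ κ := by
    simpa using Real.rpow_le_rpow_of_exponent_le hκ (sub_le_self 1 hs)
  have hswap : u * L ^ s ≤ κ * L * u ^ s := by
    calc u * L ^ s = u ^ (1 - s) * u ^ s * L ^ s := by
          rw [← Real.rpow_add hu, sub_add_cancel, Real.rpow_one]
      _ ≤ (κ * L) ^ (1 - s) * u ^ s * L ^ s := by gcongr
      _ = κ ^ (1 - s) * (L ^ (1 - s) * L ^ s) * u ^ s := by
          rw [Real.mul_rpow (by positivity) hL.le]; ring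
      _ = κ ^ (1 - s) * L * u ^ s := by rw [← Real.rpow_add hL, sub_add_cancel, Real.rpow_one]
      _ ≤ κ * L * u ^ s := by gcongr
  have hyuL : 0 ≤ y * u / L := by positivity
  calc (L + y * u) ^ s = (1 + y * u / L) ^ s * L ^ s := by
        rw [← Real.mul_rpow (by positivity) hL.le, add_mul, one_mul, div_mul_cancel₀ _ hL.ne']
    _ ≤ (1 + s * (y * u / L)) * L ^ s := by
        gcongr
        exact rpow_one_add_le_one_add_mul_self (by linarith) hs hs1
    _ ≤ (1 + 1 * (y * u / L)) * L ^ s := by gcongr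
    _ = L ^ s + y / L * (u * L ^ s) := by ring
    _ ≤ L ^ s + y / L * (κ * L * u ^ s) := by gcongr
    _ = L ^ s + κ * y * u ^ s := by field_simp

lemma add_mul_rpow_le_rpow_add_four_mul {x r y p : ℝ} (hx : 0 ≤ x) (hxr : x ≤ r) (hy : 0 ≤ y)
    (hy1 : y ≤ 1) (hp : 1 ≤ p) (hp2 : p ≤ 2) : (x + y * r) ^ p ≤ x ^ p + 4 * y * r ^ p := by
  have hr := hx.trans hxr
  have hconv := (convexOn_rpow hp).2 (Set.mem_Ici.2 hx) (Set.mem_Ici.2 (add_nonneg hx hr))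
    (sub_nonneg.2 hy1) hy (sub_add_cancel 1 y)
  simp only [smul_eq_mul] at hconv
  have h2p : (2 : ℝ) ^ p ≤ 4 := by
    calc (2 : ℝ) ^ p ≤ 2 ^ (2 : ℝ) := Real.rpow_le_rpow_of_exponent_le one_le_two hp2
      _ = 4 := by norm_num
  calc (x + y * r) ^ p = ((1 - y) * x + y * (x + r)) ^ p := by ring_nf
    _ ≤ (1 - y) * x ^ p + y * (x + r) ^ p := hconv
    _ ≤ 1 * x ^ p + y * (2 * r) ^ p := by gcongr <;> linarith
    _ = x ^ p + 2 ^ p * y * r ^ p := by rw [Real.mul_rpow zero_le_two hr]; ring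
    _ ≤ x ^ p + 4 * y * r ^ p := by gcongr

lemma sq_le_mul_div_one_add_sq {r μ K : ℝ} (hr : 0 ≤ r) (hrK : r ≤ K) (hrμ : r ≤ μ) :
    r ^ 2 ≤ (1 + K ^ 2) * (μ ^ 2 / (1 + μ ^ 2)) := by
  rw [← mul_div_assoc, le_div_iff₀ (by positivity)]
  have h1 : r ^ 2 ≤ μ ^ 2 := by gcongr
  have h2 : r ^ 2 * μ ^ 2 ≤ K ^ 2 * μ ^ 2 := by gcongr
  linarith

lemma rpow_le_log_rpow_add_of_max {g μ r K y V p : ℝ} (hμ : 0 < μ) (hμV : μ ^ 2 ≤ V)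
    (hr : 0 < r) (hrK : r ≤ K) (hrμ : r ≤ μ) (hy : 0 ≤ y)
    (hg : (1 + V)⁻¹ * g ^ 2 ≤ (1 + V)⁻¹ * μ ^ 2 + y * r ^ 2) (hp : 1 ≤ p) (hp2 : p ≤ 2) :
    ((1 + V)⁻¹ * g ^ 2 + (logSlope V - (1 + V)⁻¹) * μ ^ 2) ^ (p / 2) ≤
      Real.log (1 + μ ^ 2) ^ (p / 2) + (1 + K ^ 2) * y * r ^ p := by
  have hV : 0 < V := lt_of_lt_of_le (by positivity) hμV
  have hμ2 : 0 < μ ^ 2 := by positivity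
  have hlog : μ ^ 2 / (1 + μ ^ 2) ≤ Real.log (1 + μ ^ 2) := by
    rw [← mul_logSlope, div_eq_mul_inv]
    gcongr
    exact inv_one_add_le_logSlope hμ2
  have hpow := add_mul_rpow_le_rpow_add (s := p / 2) (lt_of_lt_of_le (by positivity) hlog)
    (by positivity : 0 < r ^ 2)
    ((sq_le_mul_div_one_add_sq hr.le hrK hrμ).trans
      (mul_le_mul_of_nonneg_left hlog (by positivity)))
    (le_add_of_nonneg_right (sq_nonneg K)) hy (by linarith) (by linarith)
  rw [sq_rpow_half hr.le] at hpow
  have hslope := sub_nonneg.2 (inv_one_add_le_logSlope hV)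
  refine (Real.rpow_le_rpow (by positivity) ?_ (by positivity)).trans hpow
  linarith [sq_mul_logSlope_le hμV]

lemma rpow_le_rpow_add_of_le {g x r y s h p : ℝ} (hg : 0 ≤ g) (hx : 0 ≤ x) (hxr : x ≤ r)
    (hy : 0 ≤ y) (hy1 : y ≤ 1) (hs : 0 ≤ s) (hsh : s ≤ h) (hh : h ≤ 1)
    (hgx : √s * g ≤ √s * x + y * r) (hp : 1 ≤ p) (hp2 : p ≤ 2) :
    (s * g ^ 2 + (h - s) * x ^ 2) ^ (p / 2) ≤ (x ^ 2 * h) ^ (p / 2) + 4 * y * r ^ p := by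
  have hh0 := hs.trans hsh
  have hr := hx.trans hxr
  have hsq : s * g ^ 2 + (h - s) * x ^ 2 ≤ (√h * x + y * r) ^ 2 := by
    have h1 : (√s * g) ^ 2 ≤ (√s * x + y * r) ^ 2 := by gcongr
    have h2 : √s * (x * (y * r)) ≤ √h * (x * (y * r)) := by gcongr
    have h3 := Real.sq_sqrt hs
    have h4 := Real.sq_sqrt hh0
    linear_combination h1 + 2 * h2 + (x ^ 2 - g ^ 2) * h3 - x ^ 2 * h4
  have := sub_nonneg.2 hsh
  have hhx : √h * x ≤ r := (mul_le_of_le_one_left hx (Real.sqrt_le_one.2 hh)).trans hxr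
  calc (s * g ^ 2 + (h - s) * x ^ 2) ^ (p / 2) ≤ ((√h * x + y * r) ^ 2) ^ (p / 2) := by gcongr
    _ = (√h * x + y * r) ^ p := sq_rpow_half (by positivity)
    _ ≤ (√h * x) ^ p + 4 * y * r ^ p :=
        add_mul_rpow_le_rpow_add_four_mul (by positivity) hhx hy hy1 hp hp2
    _ = (x ^ 2 * h) ^ (p / 2) + 4 * y * r ^ p := by
        rw [← sq_rpow_half (by positivity), mul_pow, Real.sq_sqrt hh0, mul_comm h]

variable {ι : Type*} [Fintype ι]

lemma sum_le_sum_of_gain {f g : ι → ℝ} {l : ι} {δ γ : ℝ} (hfg : ∀ j, f j ≤ g j + δ)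
    (hl : f l + γ ≤ g l + δ) (hδ : Fintype.card ι * δ ≤ γ) : ∑ j, f j ≤ ∑ j, g j := by
  classical
  have h : ∑ j, (f j + if j = l then γ else 0) ≤ ∑ j, (g j + δ) :=
    Finset.sum_le_sum fun j _ => by
      split_ifs with hj
      · exact hj ▸ hl
      · simpa using hfg j
  simp only [Finset.sum_add_distrib, Finset.sum_ite_eq', Finset.mem_univ, if_true,
    Finset.sum_const, Finset.card_univ, nsmul_eq_mul] at h
  linarith

lemma sq_add_sq_le_sum_sq (ξ : ι → ℝ) {m l : ι} (hlm : l ≠ m) :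
    ξ m ^ 2 + ξ l ^ 2 ≤ ∑ j, ξ j ^ 2 :=
  Finset.add_le_sum (fun j _ => sq_nonneg (ξ j)) (Finset.mem_univ m) (Finset.mem_univ l) hlm.symm

lemma div_le_gain {ξ : ι → ℝ} {m l : ι} {K : ℝ} (hlm : l ≠ m) (hξ : ∀ j, 0 ≤ ξ j)
    (hm : ∀ j, ξ j ≤ ξ m) (hK : ξ l ≤ K) :
    ξ m ^ 2 / (1 + ξ m ^ 2) / (4 * Fintype.card ι * (1 + K ^ 2)) ≤
      ((∑ j, ξ j ^ 2) - ξ l ^ 2) / (4 * (1 + ξ l ^ 2) * (1 + ∑ j, ξ j ^ 2)) := by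
  have : Nonempty ι := ⟨m⟩
  have hn : (1 : ℝ) ≤ Fintype.card ι := Nat.one_le_cast.2 Fintype.card_pos
  have hsum : ∑ j, ξ j ^ 2 ≤ Fintype.card ι * ξ m ^ 2 := by
    calc ∑ j, ξ j ^ 2 ≤ ∑ _ : ι, ξ m ^ 2 :=
          Finset.sum_le_sum fun j _ => pow_le_pow_left₀ (hξ j) (hm j) 2
      _ = Fintype.card ι * ξ m ^ 2 := by simp
  have hgap := sq_add_sq_le_sum_sq ξ hlm
  have hl := hξ l
  have : 0 ≤ ∑ j, ξ j ^ 2 := by positivity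
  rw [div_div]
  refine div_le_div₀ (by linarith [sq_nonneg (ξ m)]) (by linarith) (by positivity) ?_
  calc 4 * (1 + ξ l ^ 2) * (1 + ∑ j, ξ j ^ 2)
      ≤ 4 * (1 + K ^ 2) * (Fintype.card ι + Fintype.card ι * ξ m ^ 2) := by gcongr
    _ = (1 + ξ m ^ 2) * (4 * Fintype.card ι * (1 + K ^ 2)) := by ring

theorem sum_rpow_le_sum_log_rpow {ξ g : ι → ℝ} {m l : ι} {K y V p : ℝ} (hlm : l ≠ m)
    (hξ : ∀ j, 0 ≤ ξ j) (hg : ∀ j, 0 ≤ g j) (hV : V = ∑ j, ξ j ^ 2) (hm : ∀ j, ξ j ≤ ξ m)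
    (hl : ∀ j ≠ m, ξ j ≤ ξ l) (hl0 : 0 < ξ l) (hK : ξ l ≤ K) (hy : 0 ≤ y)
    (hyθ : 16 * Fintype.card ι ^ 2 * (1 + K ^ 2) ^ 2 * y ≤ ξ m ^ 2 / (1 + ξ m ^ 2))
    (hgm : (1 + V)⁻¹ * g m ^ 2 ≤ (1 + V)⁻¹ * ξ m ^ 2 + y * ξ l ^ 2)
    (hgj : ∀ j ≠ m, √(1 + V)⁻¹ * g j ≤ √(1 + V)⁻¹ * ξ j + y * ξ l) (hp : 1 ≤ p) (hp2 : p ≤ 2) :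
    ∑ j, ((1 + V)⁻¹ * g j ^ 2 + (logSlope V - (1 + V)⁻¹) * ξ j ^ 2) ^ (p / 2) ≤
      ∑ j, Real.log (1 + ξ j ^ 2) ^ (p / 2) := by
  have : Nonempty ι := ⟨m⟩
  have hn : (1 : ℝ) ≤ Fintype.card ι := Nat.one_le_cast.2 Fintype.card_pos
  have hξV (j : ι) : ξ j ^ 2 ≤ V := hV ▸
    Finset.single_le_sum (f := fun j => ξ j ^ 2) (fun j _ => sq_nonneg _) (Finset.mem_univ j)
  have hV0 : 0 < V := lt_of_lt_of_le (by positivity) (hξV l)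
  have hκ : 1 ≤ 1 + K ^ 2 := le_add_of_nonneg_right (sq_nonneg K)
  have hy1 : y ≤ 1 := by
    have hθ : ξ m ^ 2 / (1 + ξ m ^ 2) ≤ 1 := div_le_one_of_le₀ (by linarith) (by positivity)
    have : 1 ≤ 16 * (Fintype.card ι : ℝ) ^ 2 * (1 + K ^ 2) ^ 2 :=
      one_le_mul_of_one_le_of_one_le (one_le_mul_of_one_le_of_one_le (by norm_num)
        (one_le_pow₀ hn)) (one_le_pow₀ hκ)
    exact (le_mul_of_one_le_left hy this).trans (hyθ.trans hθ)
  have hlinear (j : ι) (hj : j ≠ m) := rpow_le_rpow_add_of_le (hg j) (hξ j) (hl j hj) hy hy1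
    (by positivity) (inv_one_add_le_logSlope hV0) (logSlope_le_one hV0.le) (hgj j hj) hp hp2
  have hδ : (4 : ℝ) * y * ξ l ^ p ≤ 4 * (1 + K ^ 2) * y * ξ l ^ p := by
    gcongr
    exact le_mul_of_one_le_right zero_le_four hκ
  refine sum_le_sum_of_gain (l := l) (δ := 4 * (1 + K ^ 2) * y * ξ l ^ p)
    (γ := ξ m ^ 2 / (1 + ξ m ^ 2) / (4 * Fintype.card ι * (1 + K ^ 2)) * ξ l ^ p)
    (fun j => ?_) ?_ ?_
  · rcases eq_or_ne j m with rfl | hj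
    · refine (rpow_le_log_rpow_add_of_max (hl0.trans_le (hm l)) (hξV j) hl0 hK (hm l) hy hgm hp
        hp2).trans ?_
      gcongr
      linarith
    · refine (hlinear j hj).trans (add_le_add ?_ hδ)
      have := logSlope_nonneg hV0.le
      gcongr
      exact sq_mul_logSlope_le (hξV j)
  · have hgain := sq_mul_logSlope_rpow_add_le hl0 (hξV l) hp hp2
    have hdiv := mul_le_mul_of_nonneg_right (div_le_gain hlm hξ hm hK)
      (Real.rpow_nonneg hl0.le p)
    rw [← hV] at hdiv
    linarith [hlinear l hlm]
  · rw [← mul_assoc]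
    gcongr
    rw [le_div_iff₀ (by positivity)]
    linarith

end Comparison

section Rescaling

variable {g x μ r ε C K V : ℝ}

lemma inv_mul_sq_le_add (hg : 0 ≤ g) (hr : 0 ≤ r) (hε : 0 ≤ ε) (hε1 : ε ≤ 1) (hεr : ε * r ≤ 1)
    (hC : 0 ≤ C) (hμV : μ ^ 2 ≤ V) (hgμ : g ≤ μ * (1 + C * (ε * r) ^ 2)) :
    (1 + V)⁻¹ * g ^ 2 ≤
      (1 + V)⁻¹ * μ ^ 2 + (1 + K ^ 2) * (1 + C) ^ 2 * ε * (μ ^ 2 / (1 + μ ^ 2)) * r ^ 2 := by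
  have hV : 0 ≤ V := (sq_nonneg μ).trans hμV
  have hsμ : (1 + V)⁻¹ * μ ^ 2 ≤ μ ^ 2 / (1 + μ ^ 2) := by
    rw [inv_mul_eq_div]
    gcongr
  have hεr4 : (ε * r) ^ 4 ≤ (ε * r) ^ 2 := pow_le_pow_of_le_one (by positivity) hεr (by norm_num)
  have hε2 : ε ^ 2 ≤ ε := pow_le_of_le_one hε hε1 two_ne_zero
  have hconst : 2 * C + C ^ 2 ≤ (1 + K ^ 2) * (1 + C) ^ 2 := by
    nlinarith [mul_nonneg (sq_nonneg K) (sq_nonneg (1 + C))]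
  calc (1 + V)⁻¹ * g ^ 2 ≤ (1 + V)⁻¹ * (μ * (1 + C * (ε * r) ^ 2)) ^ 2 := by gcongr
    _ = (1 + V)⁻¹ * μ ^ 2 + (1 + V)⁻¹ * μ ^ 2 * (2 * C * (ε * r) ^ 2 + C ^ 2 * (ε * r) ^ 4) := by
        ring
    _ ≤ (1 + V)⁻¹ * μ ^ 2 + (1 + V)⁻¹ * μ ^ 2 * (2 * C * (ε * r) ^ 2 + C ^ 2 * (ε * r) ^ 2) := by
        gcongr
    _ = (1 + V)⁻¹ * μ ^ 2 + (2 * C + C ^ 2) * ε ^ 2 * ((1 + V)⁻¹ * μ ^ 2) * r ^ 2 := by ring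
    _ ≤ _ := by gcongr

lemma sqrt_one_add_mul_sq_le (hε : 0 ≤ ε) (hε1 : ε ≤ 1) :
    √(1 + (ε * μ) ^ 2) ≤ 1 + ε * (√(1 + μ ^ 2) - 1) := by
  have hw : 1 ≤ √(1 + μ ^ 2) := Real.one_le_sqrt.2 (le_add_of_nonneg_right (sq_nonneg μ))
  have hw2 : √(1 + μ ^ 2) ^ 2 = 1 + μ ^ 2 := Real.sq_sqrt (by positivity)
  have hgap : 0 ≤ ε * (1 - ε) * (√(1 + μ ^ 2) - 1) :=
    mul_nonneg (mul_nonneg hε (sub_nonneg.2 hε1)) (sub_nonneg.2 hw)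
  rw [Real.sqrt_le_left (by nlinarith)]
  linear_combination 2 * hgap - ε ^ 2 * hw2

lemma sqrt_inv_mul_sqrt_sub_one_le (hε : 0 ≤ ε) (hε1 : ε ≤ 1) (hμV : μ ^ 2 ≤ V) :
    √(1 + V)⁻¹ * (√(1 + (ε * μ) ^ 2) - 1) ≤ ε * (μ ^ 2 / (1 + μ ^ 2)) := by
  set w := √(1 + μ ^ 2)
  have hw : 1 ≤ w := Real.one_le_sqrt.2 (le_add_of_nonneg_right (sq_nonneg μ))
  have hw2 : w ^ 2 = 1 + μ ^ 2 := Real.sq_sqrt (by positivity)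
  have hA : 0 ≤ √(1 + (ε * μ) ^ 2) - 1 :=
    sub_nonneg.2 (Real.one_le_sqrt.2 (le_add_of_nonneg_right (sq_nonneg _)))
  calc √(1 + V)⁻¹ * (√(1 + (ε * μ) ^ 2) - 1) ≤ w⁻¹ * (ε * (w - 1)) := by
        rw [← Real.sqrt_inv]
        gcongr
        linarith [sqrt_one_add_mul_sq_le (μ := μ) hε hε1]
    _ = ε * ((w - 1) * w / w ^ 2) := by field_simp
    _ ≤ ε * (μ ^ 2 / (1 + μ ^ 2)) := by
        rw [hw2]
        gcongr
        nlinarith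

lemma sqrt_inv_mul_sqrt_le_one (hε : 0 ≤ ε) (hε1 : ε ≤ 1) (hμV : μ ^ 2 ≤ V) :
    √(1 + V)⁻¹ * √(1 + (ε * μ) ^ 2) ≤ 1 := by
  have hV : 0 ≤ V := (sq_nonneg μ).trans hμV
  have hεμ : (ε * μ) ^ 2 ≤ V := by
    rw [mul_pow]
    exact (mul_le_of_le_one_left (sq_nonneg μ) (pow_le_one₀ hε hε1)).trans hμV
  rw [← Real.sqrt_mul (by positivity), Real.sqrt_le_one, inv_mul_le_one₀ (by positivity)]
  gcongr

lemma sqrt_inv_mul_mul_le (hr : 0 ≤ r) (hrK : r ≤ K) (hrμ : r ≤ μ) (hμV : μ ^ 2 ≤ V) :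
    √(1 + V)⁻¹ * (μ * r) ≤ (1 + K ^ 2) * (μ ^ 2 / (1 + μ ^ 2)) := by
  have : 0 ≤ μ := hr.trans hrμ
  have hV : 0 ≤ V := (sq_nonneg μ).trans hμV
  have hκ : 1 ≤ 1 + K ^ 2 := le_add_of_nonneg_right (sq_nonneg K)
  set θ := μ ^ 2 / (1 + μ ^ 2) with hθ
  have : 0 ≤ θ := by positivity
  have hr2 : r ^ 2 ≤ (1 + K ^ 2) * θ := sq_le_mul_div_one_add_sq hr hrK hrμ
  refine le_of_sq_le_sq ?_ (by positivity)
  calc (√(1 + V)⁻¹ * (μ * r)) ^ 2 = μ ^ 2 / (1 + V) * r ^ 2 := by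
        rw [mul_pow, Real.sq_sqrt (by positivity)]; ring
    _ ≤ θ * ((1 + K ^ 2) * θ) := by rw [hθ]; gcongr
    _ = (1 + K ^ 2) * θ ^ 2 := by ring
    _ ≤ (1 + K ^ 2) ^ 2 * θ ^ 2 := by
        gcongr
        exact le_self_pow₀ hκ two_ne_zero
    _ = ((1 + K ^ 2) * θ) ^ 2 := by ring

lemma sqrt_inv_mul_le_add (hx : 0 ≤ x) (hxr : x ≤ r) (hrK : r ≤ K) (hrμ : r ≤ μ) (hε : 0 ≤ ε)
    (hε1 : ε ≤ 1) (hC : 0 ≤ C) (hμV : μ ^ 2 ≤ V)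
    (hg : g ≤ √(1 + (ε * μ) ^ 2) * (1 + C * (ε * r) ^ 2) * x + C * (ε ^ 2 * μ * r ^ 2)) :
    √(1 + V)⁻¹ * g ≤
      √(1 + V)⁻¹ * x + (1 + K ^ 2) * (1 + C) ^ 2 * ε * (μ ^ 2 / (1 + μ ^ 2)) * r := by
  have hr := hx.trans hxr
  have hμ := hr.trans hrμ
  set s := √(1 + V)⁻¹
  set A := √(1 + (ε * μ) ^ 2)
  set θ := μ ^ 2 / (1 + μ ^ 2)
  have : 0 ≤ θ := by positivity
  have hsA : s * (A - 1) ≤ ε * θ := sqrt_inv_mul_sqrt_sub_one_le hε hε1 hμV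
  have hε2 : ε ^ 2 ≤ ε := pow_le_of_le_one hε hε1 two_ne_zero
  have hquad : s * A * (C * (ε * r) ^ 2) ≤ C * (1 + K ^ 2) * ε * θ := by
    calc s * A * (C * (ε * r) ^ 2) ≤ 1 * (C * (ε * r) ^ 2) := by
          gcongr
          exact sqrt_inv_mul_sqrt_le_one hε hε1 hμV
      _ = C * (ε ^ 2 * r ^ 2) := by ring
      _ ≤ C * (ε * ((1 + K ^ 2) * θ)) := by
          gcongr
          exact sq_le_mul_div_one_add_sq hr hrK hrμ
      _ = _ := by ring
  have hcubic : s * (C * (ε ^ 2 * μ * r)) ≤ C * (1 + K ^ 2) * ε * θ := by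
    calc s * (C * (ε ^ 2 * μ * r)) = C * (ε ^ 2 * (s * (μ * r))) := by ring
      _ ≤ C * (ε * ((1 + K ^ 2) * θ)) := by
          gcongr C * ?_
          exact mul_le_mul hε2 (sqrt_inv_mul_mul_le hr hrK hrμ hμV) (by positivity) hε
      _ = _ := by ring
  have hconst : 1 + 2 * C * (1 + K ^ 2) ≤ (1 + K ^ 2) * (1 + C) ^ 2 := by
    nlinarith [sq_nonneg K, mul_nonneg (add_nonneg zero_le_one (sq_nonneg K)) (sq_nonneg C)]
  calc s * g ≤ s * (A * (1 + C * (ε * r) ^ 2) * x + C * (ε ^ 2 * μ * r ^ 2)) := by gcongr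
    _ = s * x + (s * (A - 1) + s * A * (C * (ε * r) ^ 2)) * x + s * (C * (ε ^ 2 * μ * r)) * r := by
        ring
    _ ≤ s * x + (ε * θ + C * (1 + K ^ 2) * ε * θ) * r + C * (1 + K ^ 2) * ε * θ * r := by gcongr
    _ = s * x + (1 + 2 * C * (1 + K ^ 2)) * ε * θ * r := by ring
    _ ≤ s * x + (1 + K ^ 2) * (1 + C) ^ 2 * ε * θ * r := by gcongr

theorem sum_rpow_le_sum_log_rpow_of_small {ι : Type*} [Fintype ι] {ξ g : ι → ℝ} {m l : ι} {p : ℝ}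
    (hlm : l ≠ m) (hξ : ∀ j, 0 ≤ ξ j) (hg : ∀ j, 0 ≤ g j) (hV : V = ∑ j, ξ j ^ 2)
    (hm : ∀ j, ξ j ≤ ξ m) (hl : ∀ j ≠ m, ξ j ≤ ξ l) (hl0 : 0 < ξ l) (hK : ξ l ≤ K) (hε : 0 ≤ ε)
    (hε1 : ε ≤ 1) (hεl : ε * ξ l ≤ 1) (hC : 0 ≤ C)
    (hεK : 16 * Fintype.card ι ^ 2 * (1 + K ^ 2) ^ 3 * (1 + C) ^ 2 * ε ≤ 1)
    (hgm : g m ≤ ξ m * (1 + C * (ε * ξ l) ^ 2))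
    (hgj : ∀ j ≠ m, g j ≤ √(1 + (ε * ξ m) ^ 2) * (1 + C * (ε * ξ l) ^ 2) * ξ j +
      C * (ε ^ 2 * ξ m * ξ l ^ 2)) (hp : 1 ≤ p) (hp2 : p ≤ 2) :
    ∑ j, ((1 + V)⁻¹ * g j ^ 2 + (logSlope V - (1 + V)⁻¹) * ξ j ^ 2) ^ (p / 2) ≤
      ∑ j, Real.log (1 + ξ j ^ 2) ^ (p / 2) := by
  have hmV : ξ m ^ 2 ≤ V := by linarith [sq_add_sq_le_sum_sq ξ hlm, sq_nonneg (ξ l)]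
  refine sum_rpow_le_sum_log_rpow (K := K)
    (y := (1 + K ^ 2) * (1 + C) ^ 2 * ε * (ξ m ^ 2 / (1 + ξ m ^ 2))) hlm hξ hg hV hm hl hl0 hK
    (by positivity) ?_ (inv_mul_sq_le_add (hg m) hl0.le hε hε1 hεl hC hmV hgm) (fun j hj =>
      sqrt_inv_mul_le_add (hξ j) (hl j hj) hK (hm l) hε hε1 hC hmV (hgj j hj)) hp hp2
  calc 16 * (Fintype.card ι : ℝ) ^ 2 * (1 + K ^ 2) ^ 2 *
        ((1 + K ^ 2) * (1 + C) ^ 2 * ε * (ξ m ^ 2 / (1 + ξ m ^ 2)))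
      = 16 * Fintype.card ι ^ 2 * (1 + K ^ 2) ^ 3 * (1 + C) ^ 2 * ε *
          (ξ m ^ 2 / (1 + ξ m ^ 2)) := by ring
    _ ≤ ξ m ^ 2 / (1 + ξ m ^ 2) := mul_le_of_le_one_left (by positivity) hεK

end Rescaling

section LogarithmicHausdorffYoung

open scoped Matrix

variable {ι : Type*} [Fintype ι] {p q ε : ℝ}

lemma rpow_sum_le_sum_rpow {f : ι → ℝ} (hf : ∀ j, 0 ≤ f j) {s : ℝ} (hs : 0 < s) (hs1 : s ≤ 1) :
    (∑ j, f j) ^ s ≤ ∑ j, f j ^ s :=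
  Finset.le_sum_of_subadditive_on_pred (· ^ s) (0 ≤ ·) (Real.zero_rpow hs.ne').le
    (fun _ _ hx hy => Real.rpow_add_le_add_rpow hx hy hs.le hs1) (fun _ _ => add_nonneg) f
    fun j _ => hf j

lemma powerMean_le_of_le_sum {y f : ι → ℝ} (hy : ∀ k, 0 ≤ y k) (hf : ∀ j, 0 ≤ f j)
    (hyf : ∀ k, y k ≤ ∑ j, f j) (hpq : p.HolderConjugate q) (hp : p ≤ 2) :
    ((1 / Fintype.card ι : ℝ) * ∑ k, y k ^ (q / 2)) ^ (1 / q) ≤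
      (∑ j, f j ^ (p / 2)) ^ (1 / p) := by
  have hp0 := hpq.pos
  have hq0 := hpq.symm.pos
  set F := ∑ j, f j
  have hF : 0 ≤ F := Finset.sum_nonneg fun j _ => hf j
  have rpow_half {r : ℝ} (hr : 0 < r) : (F ^ (r / 2)) ^ (1 / r) = F ^ (1 / 2 : ℝ) := by
    rw [← Real.rpow_mul hF]
    congr 1
    field_simp
  have hy_sum : 0 ≤ ∑ k, y k ^ (q / 2) := Finset.sum_nonneg fun k _ => Real.rpow_nonneg (hy k) _
  have hmean : (1 / Fintype.card ι : ℝ) * ∑ k, y k ^ (q / 2) ≤ F ^ (q / 2) := by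
    rw [one_div_mul_eq_div]
    refine div_le_of_le_mul₀ (Nat.cast_nonneg _) (by positivity) ?_
    calc ∑ k, y k ^ (q / 2) ≤ ∑ _ : ι, F ^ (q / 2) :=
          Finset.sum_le_sum fun k _ => Real.rpow_le_rpow (hy k) (hyf k) (by positivity)
      _ = F ^ (q / 2) * Fintype.card ι := by simp [mul_comm]
  calc _ ≤ (F ^ (q / 2)) ^ (1 / q) := by gcongr
    _ = (F ^ (p / 2)) ^ (1 / p) := by rw [rpow_half hq0, rpow_half hp0]
    _ ≤ _ := by
        gcongr
        exact rpow_sum_le_sum_rpow hf (by positivity) (by linarith)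

lemma log_one_add_sq_nonneg (t : ℝ) : 0 ≤ Real.log (1 + t ^ 2) :=
  Real.log_nonneg (le_add_of_nonneg_right (sq_nonneg t))

section TwoLarge

variable {x : ι → ℝ} {m l : ι}

lemma sq_sinh_sum_arsinh_le [DecidableEq ι] (hx : ∀ j, 0 ≤ x j) (hm : ∀ j, x j ≤ x m) :
    Real.sinh (∑ j, Real.arsinh (x j)) ^ 2 ≤
      x m ^ 2 * (4 ^ Fintype.card ι * ∏ j ∈ Finset.univ.erase m, (1 + x j ^ 2)) := by
  have hsum : 0 ≤ ∑ j, Real.arsinh (x j) :=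
    Finset.sum_nonneg fun j _ => Real.arsinh_nonneg_iff.2 (hx j)
  have hsinh := sinh_add_sum_le (Finset.univ.erase m) (t := fun j => Real.arsinh (x j)) fun j _ =>
    ⟨Real.arsinh_nonneg_iff.2 (hx j), Real.arsinh_le_arsinh.2 (hm j)⟩
  rw [Finset.add_sum_erase _ (fun j => Real.arsinh (x j)) (Finset.mem_univ m)] at hsinh
  simp only [Real.sinh_arsinh, Real.cosh_arsinh] at hsinh
  have hxm := hx m
  calc Real.sinh (∑ j, Real.arsinh (x j)) ^ 2
      ≤ (2 ^ Fintype.card ι * (x m * ∏ j ∈ Finset.univ.erase m, √(1 + x j ^ 2))) ^ 2 := by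
        have := Real.sinh_nonneg_iff.2 hsum
        gcongr
        refine hsinh.trans ?_
        gcongr
        · exact one_le_two
        · exact Finset.card_le_univ _
    _ = x m ^ 2 * ((2 ^ Fintype.card ι) ^ 2 *
          ∏ j ∈ Finset.univ.erase m, √(1 + x j ^ 2) ^ 2) := by
        rw [Finset.prod_pow]; ring
    _ = _ := by
        rw [pow_right_comm]
        congr 2
        · norm_num
        · exact Finset.prod_congr rfl fun j _ => Real.sq_sqrt (by positivity)

lemma four_pow_mul_one_add_sq_le {n : ℕ} {z : ℝ} (hε : 0 < ε) (hεn : 2 * 2 ^ n * ε ≤ 1)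
    (hz : 2 * 2 ^ n * ε ≤ z) : 4 ^ n * (1 + z ^ 2) ≤ 1 + (z / ε) ^ 2 := by
  have hsplit : (4 : ℝ) ^ n = (2 * 2 ^ n) ^ 2 / 4 := by
    rw [mul_pow, pow_right_comm]; norm_num
  have hlarge : (2 * 2 ^ n) ^ 2 ≤ (z / ε) ^ 2 := by
    gcongr
    rwa [le_div_iff₀ hε]
  have hsmall : (2 * 2 ^ n) ^ 2 * z ^ 2 ≤ (z / ε) ^ 2 := by
    calc (2 * 2 ^ n) ^ 2 * z ^ 2 = (2 * 2 ^ n * ε) ^ 2 * (z / ε) ^ 2 := by field_simp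
      _ ≤ 1 ^ 2 * (z / ε) ^ 2 := by gcongr
      _ = (z / ε) ^ 2 := by ring
  rw [hsplit]
  linarith [sq_nonneg (z / ε)]

theorem log_one_add_sq_le_sum_of_two_large (hx : ∀ j, 0 ≤ x j) (hm : ∀ j, x j ≤ x m)
    (hlm : l ≠ m) (hε : 0 < ε) (hε1 : ε ≤ 1) (hεn : 2 * 2 ^ Fintype.card ι * ε ≤ 1)
    (hl : 2 * 2 ^ Fintype.card ι * ε ≤ x l) :
    Real.log (1 + (Real.sinh (∑ j, Real.arsinh (x j)) / ε) ^ 2) ≤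
      ∑ j, Real.log (1 + (x j / ε) ^ 2) := by
  classical
  set s := Finset.univ.erase m with hs
  have hls : l ∈ s := Finset.mem_erase.2 ⟨hlm, Finset.mem_univ l⟩
  have hprod : 4 ^ Fintype.card ι * ∏ j ∈ s, (1 + x j ^ 2) ≤ ∏ j ∈ s, (1 + (x j / ε) ^ 2) := by
    rw [← Finset.mul_prod_erase _ _ hls, ← Finset.mul_prod_erase _ _ hls, ← mul_assoc]
    refine mul_le_mul (four_pow_mul_one_add_sq_le hε hεn hl)
      (Finset.prod_le_prod (fun j _ => by positivity) fun j _ => ?_)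
      (Finset.prod_nonneg fun j _ => by positivity) (by positivity)
    have := hx j
    gcongr
    exact le_div_self this hε hε1
  have hone : 1 ≤ ∏ j ∈ s, (1 + (x j / ε) ^ 2) :=
    Finset.one_le_prod fun j _ => le_add_of_nonneg_right (sq_nonneg _)
  rw [← Real.log_prod fun j _ => by positivity]
  gcongr
  rw [← Finset.mul_prod_erase _ _ (Finset.mem_univ m), ← hs]
  calc 1 + (Real.sinh (∑ j, Real.arsinh (x j)) / ε) ^ 2
      ≤ 1 + x m ^ 2 * (4 ^ Fintype.card ι * ∏ j ∈ s, (1 + x j ^ 2)) / ε ^ 2 := by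
        rw [div_pow]
        gcongr
        exact sq_sinh_sum_arsinh_le hx hm
    _ ≤ ∏ j ∈ s, (1 + (x j / ε) ^ 2) + x m ^ 2 * (∏ j ∈ s, (1 + (x j / ε) ^ 2)) / ε ^ 2 := by
        gcongr
    _ = _ := by ring

end TwoLarge

theorem log_hausdorffYoung_tangent [DecidableEq ι] [Nonempty ι] {T : Matrix ι ι ℂ}
    (hT : T.IsHadamard) (c : ι → ℂ) {ξ : ι → ℝ} {V : ℝ} (hV : V = ∑ j, ξ j ^ 2) (hV0 : 0 < V)
    (hpq : p.HolderConjugate q) (hp : p ≤ 2) :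
    ((1 / Fintype.card ι : ℝ) * ∑ k, Real.log (1 + ‖(T *ᵥ c) k‖ ^ 2) ^ (q / 2)) ^ (1 / q) ≤
      (∑ j, ((1 + V)⁻¹ * ‖c j‖ ^ 2 + (logSlope V - (1 + V)⁻¹) * ξ j ^ 2) ^ (p / 2)) ^ (1 / p) := by
  have hq0 := hpq.symm.pos
  have hslope : 0 ≤ logSlope V - (1 + V)⁻¹ := sub_nonneg.2 (inv_one_add_le_logSlope hV0)
  have hHY := hausdorffYoung_of_isHadamard hT hpq hp ((√(1 + V)⁻¹ : ℂ) • c)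
    fun j => √(logSlope V - (1 + V)⁻¹) * ξ j
  have norm_sqrt_mul (z : ℂ) : ‖(√(1 + V)⁻¹ : ℂ) * z‖ ^ 2 = (1 + V)⁻¹ * ‖z‖ ^ 2 := by
    rw [norm_mul, mul_pow, Complex.norm_real, Real.norm_of_nonneg (Real.sqrt_nonneg _),
      Real.sq_sqrt (by positivity)]
  simp only [Matrix.mulVec_smul, Pi.smul_apply, smul_eq_mul, norm_sqrt_mul, mul_pow,
    Real.sq_sqrt hslope, ← Finset.mul_sum, ← hV] at hHY
  refine le_trans ?_ hHY
  have hlog (u : ℝ) := log_one_add_sq_nonneg u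
  gcongr with k
  · exact mul_nonneg (by positivity) (Finset.sum_nonneg fun k _ => Real.rpow_nonneg (hlog _) _)
  · exact hlog _
  · refine (log_one_add_le_tangent (sq_nonneg _) hV0.le).trans_eq ?_
    rw [← mul_logSlope]
    ring

end LogarithmicHausdorffYoung

section NonlinearHausdorffYoung

open scoped Matrix

variable {n : ℕ} {T : Matrix (Fin n) (Fin n) ℂ} {a b : Fin n → ℂ} {ξ : Fin n → ℝ} {m l : Fin n}
  {K p q ε : ℝ}

lemma exists_mulVec_eq_su11Prod_div (hT : T.IsHadamard) (hab : ∀ j, ‖a j‖ ^ 2 - ‖b j‖ ^ 2 = 1)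
    (hε : 0 < ε) (hξ : ∀ j, ‖b j‖ = ε * ξ j) (hl0 : 0 ≤ ξ l) (hl : ∀ j ≠ m, ξ j ≤ ξ l)
    (hlm : ξ l ≤ ξ m) (hnl : n * (ε * ξ l) ≤ 1) :
    ∃ c : Fin n → ℂ, (∀ k, (T *ᵥ c) k = su11Prod a (T k * b) 1 0 / ε) ∧
      ‖c m‖ ≤ ξ m * (1 + 4 * n ^ 3 * (ε * ξ l) ^ 2) ∧
      ∀ j ≠ m, ‖c j‖ ≤ √(1 + (ε * ξ m) ^ 2) * (1 + 4 * n ^ 3 * (ε * ξ l) ^ 2) * ξ j +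
        4 * n ^ 3 * (ε ^ 2 * ξ m * ξ l ^ 2) := by
  obtain ⟨c, hTc, hcm, hcj⟩ := exists_mulVec_eq_su11Prod (ρ := ε * ξ l) (m := m) hT hab
    (by positivity) (fun j hj => hξ j ▸ mul_le_mul_of_nonneg_left (hl j hj) hε.le)
    (hξ m ▸ mul_le_mul_of_nonneg_left hlm hε.le) hnl
  have ham : ‖a m‖ = √(1 + (ε * ξ m) ^ 2) := by
    rw [← hξ, ← Real.sqrt_sq (norm_nonneg (a m))]
    congr 1
    linarith [hab m]
  have norm_inv_mul (z : ℂ) : ‖(ε⁻¹ : ℂ) * z‖ = ‖z‖ / ε := by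
    rw [norm_mul, norm_inv, Complex.norm_real, Real.norm_of_nonneg hε.le, inv_mul_eq_div]
  simp only [ham, hξ] at hcm hcj
  refine ⟨(ε⁻¹ : ℂ) • c, fun k => ?_, ?_, fun j hj => ?_⟩
  · rw [Matrix.mulVec_smul, Pi.smul_apply, smul_eq_mul, hTc, inv_mul_eq_div]
  · rw [Pi.smul_apply, smul_eq_mul, norm_inv_mul, div_le_iff₀ hε]
    linarith
  · rw [Pi.smul_apply, smul_eq_mul, norm_inv_mul, div_le_iff₀ hε]
    linarith [hcj j hj]

theorem log_hausdorffYoung_of_small (hT : T.IsHadamard) (hab : ∀ j, ‖a j‖ ^ 2 - ‖b j‖ ^ 2 = 1)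
    (hε : 0 < ε) (hε1 : ε ≤ 1) (hξ : ∀ j, ‖b j‖ = ε * ξ j) (hlm : l ≠ m) (hm : ∀ j, ξ j ≤ ξ m)
    (hl : ∀ j ≠ m, ξ j ≤ ξ l) (hl0 : 0 < ξ l) (hK : ξ l ≤ K) (hnK : n * (ε * K) ≤ 1)
    (hεK : 16 * n ^ 2 * (1 + K ^ 2) ^ 3 * (1 + 4 * n ^ 3) ^ 2 * ε ≤ 1)
    (hpq : p.HolderConjugate q) (hp : p ≤ 2) :
    ((1 / n : ℝ) * ∑ k, Real.log (1 + (‖su11Prod a (T k * b) 1 0‖ / ε) ^ 2) ^ (q / 2)) ^ (1 / q) ≤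
      (∑ j, Real.log (1 + ξ j ^ 2) ^ (p / 2)) ^ (1 / p) := by
  have : Nonempty (Fin n) := ⟨m⟩
  have hn : (1 : ℝ) ≤ n := Nat.one_le_cast.2 (Fin.pos m)
  have hξ0 (j : Fin n) : 0 ≤ ξ j := nonneg_of_mul_nonneg_right (hξ j ▸ norm_nonneg _) hε
  have hV0 : 0 < ∑ j, ξ j ^ 2 := lt_of_lt_of_le (by positivity) (sq_add_sq_le_sum_sq ξ hlm)
  have hnl : n * (ε * ξ l) ≤ 1 := le_trans (by gcongr) hnK
  obtain ⟨c, hTc, hcm, hcj⟩ := exists_mulVec_eq_su11Prod_div hT hab hε hξ hl0.le hl (hm l) hnl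
  have hHY := log_hausdorffYoung_tangent hT c (ξ := ξ) rfl hV0 hpq hp
  simp only [hTc, norm_div, Complex.norm_real, Real.norm_of_nonneg hε.le, Fintype.card_fin] at hHY
  refine hHY.trans (Real.rpow_le_rpow (Finset.sum_nonneg fun j _ => Real.rpow_nonneg ?_ _) ?_
    (one_div_nonneg.2 hpq.nonneg))
  · have := sub_nonneg.2 (inv_one_add_le_logSlope hV0)
    positivity
  · exact sum_rpow_le_sum_log_rpow_of_small hlm hξ0 (fun j => norm_nonneg _) rfl hm hl hl0 hK hε.le
      hε1 ((le_mul_of_one_le_left (by positivity) hn).trans hnl) (by positivity)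
      (by rwa [Fintype.card_fin]) hcm hcj hpq.lt.le hp

lemma log_one_add_sq_le_sum_of_eq_zero {ι : Type*} [Fintype ι] {x : ι → ℝ} {m : ι}
    (hx : ∀ j ≠ m, x j = 0) :
    Real.log (1 + (Real.sinh (∑ j, Real.arsinh (x j)) / ε) ^ 2) ≤
      ∑ j, Real.log (1 + (x j / ε) ^ 2) := by
  rw [Fintype.sum_eq_single m fun j hj => by rw [hx j hj, Real.arsinh_zero], Real.sinh_arsinh]
  exact Finset.single_le_sum (f := fun j => Real.log (1 + (x j / ε) ^ 2))
    (fun j _ => log_one_add_sq_nonneg _) (Finset.mem_univ m)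

theorem log_hausdorffYoung_of_log_sinh_le (hT : T.IsHadamard)
    (hab : ∀ j, ‖a j‖ ^ 2 - ‖b j‖ ^ 2 = 1) (hε : 0 < ε)
    (h : Real.log (1 + (Real.sinh (∑ j, Real.arsinh ‖b j‖) / ε) ^ 2) ≤
      ∑ j, Real.log (1 + (‖b j‖ / ε) ^ 2)) (hpq : p.HolderConjugate q) (hp : p ≤ 2) :
    ((1 / n : ℝ) * ∑ k, Real.log (1 + (‖su11Prod a (T k * b) 1 0‖ / ε) ^ 2) ^ (q / 2)) ^ (1 / q) ≤
      (∑ j, Real.log (1 + (‖b j‖ / ε) ^ 2) ^ (p / 2)) ^ (1 / p) := by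
  have hmean := powerMean_le_of_le_sum
    (y := fun k => Real.log (1 + (‖su11Prod a (T k * b) 1 0‖ / ε) ^ 2))
    (fun k => log_one_add_sq_nonneg _) (fun j => log_one_add_sq_nonneg (‖b j‖ / ε))
    (fun k => le_trans ?_ h) hpq hp
  · rwa [Fintype.card_fin] at hmean
  · gcongr
    exact norm_su11Prod_hadamard_le hT hab k

lemma exists_pos_le_one_of_mul_le_one {x y : ℝ} (hx : 0 ≤ x) (hy : 0 ≤ y) :
    ∃ ε : ℝ, 0 < ε ∧ ε ≤ 1 ∧ x * ε ≤ 1 ∧ y * ε ≤ 1 := by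
  refine ⟨(1 + x + y)⁻¹, by positivity, inv_le_one_of_one_le₀ (by linarith), ?_, ?_⟩ <;>
  · rw [← div_eq_mul_inv, div_le_one (by positivity)]
    linarith

variable (n) in
theorem exists_log_hausdorffYoung [NeZero n] : ∃ ε : ℝ, 0 < ε ∧ ε ≤ 1 ∧
    ∀ T : Matrix (Fin n) (Fin n) ℂ, T.IsHadamard → ∀ a b : Fin n → ℂ,
      (∀ j, ‖a j‖ ^ 2 - ‖b j‖ ^ 2 = 1) → ∀ p q : ℝ, p.HolderConjugate q → p ≤ 2 →
      ((1 / n : ℝ) * ∑ k, Real.log (1 + (‖su11Prod a (T k * b) 1 0‖ / ε) ^ 2) ^ (q / 2)) ^ (1 / q) ≤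
        (∑ j, Real.log (1 + (‖b j‖ / ε) ^ 2) ^ (p / 2)) ^ (1 / p) := by
  set K : ℝ := 2 * 2 ^ n
  obtain ⟨ε, hε, hε1, hnK, hεK⟩ := exists_pos_le_one_of_mul_le_one (x := n * K)
    (y := 16 * n ^ 2 * (1 + K ^ 2) ^ 3 * (1 + 4 * n ^ 3) ^ 2) (by positivity) (by positivity)
  have hn : (1 : ℝ) ≤ n := Nat.one_le_cast.2 (NeZero.pos n)
  have hKε : K * ε ≤ 1 := le_trans (by gcongr; exact le_mul_of_one_le_left (by positivity) hn) hnK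
  refine ⟨ε, hε, hε1, fun T hT a b hab p q hpq hp => ?_⟩
  obtain ⟨m, hm⟩ := Finite.exists_max fun j => ‖b j‖
  by_cases hb : ∀ j ≠ m, ‖b j‖ = 0
  · exact log_hausdorffYoung_of_log_sinh_le hT hab hε (log_one_add_sq_le_sum_of_eq_zero hb) hpq hp
  push Not at hb
  obtain ⟨i, him, hi⟩ := hb
  obtain ⟨l, hlm, hl⟩ := Set.exists_max_image {m}ᶜ (fun j => ‖b j‖) (Set.toFinite _) ⟨i, him⟩
  rcases le_or_gt (K * ε) ‖b l‖ with hlarge | hsmall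
  · exact log_hausdorffYoung_of_log_sinh_le hT hab hε (log_one_add_sq_le_sum_of_two_large
      (fun j => norm_nonneg _) hm hlm hε hε1 (by simpa using hKε) (by simpa using hlarge)) hpq hp
  · refine log_hausdorffYoung_of_small (l := l) (m := m) hT hab hε hε1
      (fun j => (mul_div_cancel₀ _ hε.ne').symm) hlm (fun j => ?_) (fun j hj => ?_) ?_
      ((div_le_iff₀ hε).2 hsmall.le) (by linarith) hεK hpq hp
    · gcongr
      exact hm j
    · gcongr
      exact hl j hj
    · exact div_pos (((norm_nonneg _).lt_of_ne' hi).trans_le (hl i him)) hε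

end NonlinearHausdorffYoung

section LogGauge

/-- The function `β` of the theorem, at scale `ε`: up to the scale `ε` it is comparable to `t`, and
beyond that scale it grows like `ε * √(log t)`. -/
noncomputable def logGauge (ε : ℝ) (t : ℝ≥0) : ℝ≥0 :=
  (ε * √(Real.log (1 + (t / ε) ^ 2))).toNNReal

variable {ε : ℝ}

lemma coe_logGauge (hε : 0 ≤ ε) (t : ℝ≥0) :
    (logGauge ε t : ℝ) = ε * √(Real.log (1 + (t / ε) ^ 2)) :=
  Real.coe_toNNReal _ (by positivity)

lemma coe_logGauge_rpow (hε : 0 ≤ ε) (t : ℝ≥0) (r : ℝ) :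
    (logGauge ε t : ℝ) ^ r = ε ^ r * Real.log (1 + (t / ε) ^ 2) ^ (r / 2) := by
  rw [coe_logGauge hε, Real.mul_rpow hε (Real.sqrt_nonneg _), Real.sqrt_eq_rpow,
    ← Real.rpow_mul (log_one_add_sq_nonneg _), one_div_mul_eq_div]

lemma rpow_mul_rpow_one_div {x r : ℝ} (hε : 0 ≤ ε) (hr : r ≠ 0) (hx : 0 ≤ x) :
    (ε ^ r * x) ^ (1 / r) = ε * x ^ (1 / r) := by
  rw [Real.mul_rpow (by positivity) hx, one_div, Real.rpow_rpow_inv hε hr]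

lemma sqrt_log_le_logGauge (hε : 0 < ε) (hε1 : ε ≤ 1) (t : ℝ≥0) :
    ε * √(Real.log (1 + (t : ℝ) ^ 2)) ≤ logGauge ε t := by
  rw [coe_logGauge hε.le]
  gcongr
  exact le_div_self t.2 hε hε1

lemma logGauge_le_sqrt_log (hε : 0 < ε) (hε1 : ε ≤ 1) (t : ℝ≥0) :
    logGauge ε t ≤ √(Real.log (1 + (t : ℝ) ^ 2)) := by
  have bernoulli : (1 + (t / ε) ^ 2) ^ (ε ^ 2) ≤ 1 + (t : ℝ) ^ 2 :=
    (rpow_one_add_le_one_add_mul_self (neg_one_lt_zero.le.trans (sq_nonneg _)) (sq_nonneg ε)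
      (pow_le_one₀ hε.le hε1)).trans_eq (by field_simp)
  calc (logGauge ε t : ℝ) = √(Real.log ((1 + (t / ε) ^ 2) ^ (ε ^ 2))) := by
        rw [coe_logGauge hε.le, Real.log_rpow (by positivity), Real.sqrt_mul (sq_nonneg ε),
          Real.sqrt_sq hε.le]
    _ ≤ _ := by gcongr

end LogGauge

section SU11Gauge

lemma su11Matrix_mem_SU11_iff {a b : ℂ} : su11Matrix a b ∈ SU11 ↔ ‖a‖ ^ 2 - ‖b‖ ^ 2 = 1 := by
  refine ⟨?_, fun h => ⟨a, b, h, rfl⟩⟩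
  rintro ⟨a', b', h, heq⟩
  obtain rfl : a = a' := congrFun₂ heq 0 0
  obtain rfl : b = b' := congrFun₂ heq 1 0
  exact h

lemma sqrt_log_one_add_sq_eq {a b : ℂ} (hab : su11Matrix a b ∈ SU11) :
    √(Real.log (1 + ‖b‖ ^ 2)) = √2 * √(Real.log ‖a‖) := by
  rw [← su11Matrix_mem_SU11_iff.1 hab, sub_add_cancel, Real.log_pow, Nat.cast_two,
    Real.sqrt_mul zero_le_two]

theorem logGauge_equiv_sqrt_log {ε : ℝ} (hε : 0 < ε) (hε1 : ε ≤ 1) {a b : ℂ}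
    (hab : su11Matrix a b ∈ SU11) :
    (√2 / ε)⁻¹ * √(Real.log ‖a‖) ≤ logGauge ε ‖b‖₊ ∧
      logGauge ε ‖b‖₊ ≤ √2 / ε * √(Real.log ‖a‖) := by
  have lower := sqrt_log_le_logGauge hε hε1 ‖b‖₊
  have upper := logGauge_le_sqrt_log hε hε1 ‖b‖₊
  rw [coe_nnnorm, sqrt_log_one_add_sq_eq hab] at lower upper
  have one_le_sqrt_two : 1 ≤ √2 := Real.one_le_sqrt.2 one_le_two
  constructor
  · refine le_trans ?_ lower
    rw [inv_div, ← mul_assoc]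
    gcongr
    exact (div_le_self hε.le one_le_sqrt_two).trans (le_mul_of_one_le_right hε.le one_le_sqrt_two)
  · refine upper.trans ?_
    gcongr
    exact le_div_self (by positivity) hε hε1

theorem exists_logGauge_hausdorffYoung (n : ℕ) [NeZero n] : ∃ ε : ℝ, 0 < ε ∧ ε ≤ 1 ∧
    ∀ T : Matrix (Fin n) (Fin n) ℂ, T.IsHadamard → ∀ a b : Fin n → ℂ,
      (∀ j, su11Matrix (a j) (b j) ∈ SU11) → ∀ p q : ℝ, p.HolderConjugate q → p ≤ 2 →
      ((1 / n : ℝ) * ∑ k, (logGauge ε ‖su11Prod a (T k * b) 1 0‖₊ : ℝ) ^ q) ^ (1 / q) ≤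
        (∑ j, (logGauge ε ‖b j‖₊ : ℝ) ^ p) ^ (1 / p) := by
  obtain ⟨ε, hε, hε1, h⟩ := exists_log_hausdorffYoung n
  refine ⟨ε, hε, hε1, fun T hT a b hab p q hpq hp => ?_⟩
  have sum_nonneg (x : Fin n → ℝ) (r : ℝ) : 0 ≤ ∑ j, Real.log (1 + (x j / ε) ^ 2) ^ r :=
    Finset.sum_nonneg fun j _ => Real.rpow_nonneg (log_one_add_sq_nonneg _) r
  simp only [coe_logGauge_rpow hε.le, coe_nnnorm, ← Finset.mul_sum]
  rw [mul_left_comm, rpow_mul_rpow_one_div hε.le hpq.symm.ne_zero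
      (mul_nonneg (by positivity) (sum_nonneg _ _)),
    rpow_mul_rpow_one_div hε.le hpq.ne_zero (sum_nonneg _ _)]
  exact mul_le_mul_of_nonneg_left
    (h T hT a b (fun j => su11Matrix_mem_SU11_iff.1 (hab j)) p q hpq hp) hε.le

end SU11Gauge

lemma twistedProduct_eq_su11Prod {d : ℕ} (k : Fin d) (a b : Fin d → ℂ) :
    twistedProduct d k a b = su11Prod a (fourierMatrix d k * b) := by
  have exp_eq (j : Fin d) :
      Complex.exp (2 * Real.pi * Complex.I * j * k / d) = fourierMatrix d k j := by
    rw [fourierMatrix, Matrix.of_apply, ← Complex.exp_nat_mul]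
    congr 1
    push_cast
    ring
  have exp_neg_eq (j : Fin d) :
      Complex.exp (-(2 * Real.pi * Complex.I * j * k / d)) = conj (fourierMatrix d k j) := by
    rw [← exp_eq, ← Complex.exp_conj]
    simp [neg_div, Complex.conj_ofNat]
  simp only [twistedProduct, su11Prod, twistedMatrix, su11Matrix, exp_eq, exp_neg_eq, Pi.mul_apply,
    map_mul, mul_comm (b _), mul_comm (conj (b _))]

theorem proposition2_general (d : ℕ) (hd : d ≠ 0) :
    ∃ C : ℝ, 0 < C ∧ ∃ β : ℝ≥0 → ℝ≥0,
      (∀ a b : ℂ, su11Matrix a b ∈ SU11 →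
        C⁻¹ * √(Real.log ‖a‖) ≤ (β ‖b‖₊ : ℝ) ∧ (β ‖b‖₊ : ℝ) ≤ C * √(Real.log ‖a‖)) ∧
      (∀ T : Matrix (Fin d) (Fin d) ℂ, T.IsHadamard → ∀ a b A B : Fin d → ℂ,
        (∀ j, su11Matrix (a j) (b j) ∈ SU11) →
        (∀ k, su11Matrix (A k) (B k) = su11Prod a (T k * b)) →
        ∀ p q : ℝ, p ≤ 2 → p.HolderConjugate q →
          ((1 / (d : ℝ)) * ∑ k : Fin d, (β ‖B k‖₊ : ℝ) ^ q) ^ (1 / q) ≤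
            (∑ j : Fin d, (β ‖b j‖₊ : ℝ) ^ p) ^ (1 / p)) := by
  have : NeZero d := ⟨hd⟩
  obtain ⟨ε, hε, hε1, h⟩ := exists_logGauge_hausdorffYoung d
  refine ⟨√2 / ε, by positivity, logGauge ε, fun a b => logGauge_equiv_sqrt_log hε hε1,
    fun T hT a b A B hab hAB p q hp hpq => ?_⟩
  obtain rfl : B = fun k => su11Prod a (T k * b) 1 0 := funext fun k => congrFun₂ (hAB k) 1 0
  exact h T hT a b hab p q hpq hp

theorem proposition2 (d : ℕ) (hd : 2 ≤ d) :
    ∃ C : ℝ, 0 < C ∧ ∃ β : ℝ≥0 → ℝ≥0,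
      (∀ a b : ℂ, su11Matrix a b ∈ SU11 →
        C⁻¹ * √(Real.log ‖a‖) ≤ (β ‖b‖₊ : ℝ) ∧ (β ‖b‖₊ : ℝ) ≤ C * √(Real.log ‖a‖)) ∧
      (∀ a b A B : Fin d → ℂ,
        (∀ j, su11Matrix (a j) (b j) ∈ SU11) →
        (∀ k, su11Matrix (A k) (B k) ∈ SU11) →
        (∀ k : Fin d, su11Matrix (A k) (B k) = twistedProduct d k a b) →
        ∀ p q : ℝ, 1 < p → p ≤ 2 → p.HolderConjugate q →
          ((1 / (d : ℝ)) * ∑ k : Fin d, (β ‖B k‖₊ : ℝ) ^ q) ^ (1 / q) ≤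
            (∑ j : Fin d, (β ‖b j‖₊ : ℝ) ^ p) ^ (1 / p)) := by
  obtain ⟨C, hC, β, hβ, h⟩ := proposition2_general d (by omega)
  exact ⟨C, hC, β, hβ, fun a b A B hab _ hAB p q _ =>
    h _ (isHadamard_fourierMatrix (by omega)) a b A B hab
      (fun k => (hAB k).trans (twistedProduct_eq_su11Prod k a b)) p q⟩
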